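/- **Setting.** Let $\mathbb{X}$ be the space of continuous functions $\mathbb{R}^d\to[0,\infty)$ with the topology of locally uniform convergence and its Borel $\sigma$-algebra. Let $\Psi$ (the intensity process) and $X$ (the shape) be random elements of $\mathbb{X}$, with $\mathbb{P}_X$ the law of $X$, and let $\mu_Y>0$ be a constant. The associated Cox extremal process is $$Y(t)=\bigvee_{i=1}^\infty u_i X_i(t-s_i),\qquad t\in\mathbb{R}^d,$$ where $\sum_{i=1}^\infty\delta_{(s_i,u_i,X_i)}$ is a Cox process on $\mathbb{R}^d\times(0,\infty]\times\mathbb{X}$ which, conditionally on $\Psi=\psi$, is a Poisson process with directing measure $\mu_Y^{-1}\,\psi(s)\,ds\;u^{-2}\,du\;d\mathbb{P}_X$. Let $B_\rho(o)$ denote the closed ball of radius $\rho$ around the origin. **Proposition (Simple Simulation Algorithm).** Let $D\subset\mathbb{R}^d$ be compact and non-empty. Assume that $\inf_{s\in D}\Psi(s)>0$ almost surely, that there is $r>0$ with $\mathbb{P}\big(X(s)>0 \text{ for all } s\in B_r(o)\big)>0$, and that there are constants $C,R>0$ with $X\le C\,\mathbf{1}_{B_R(o)}$ almost surely. Put $D_R=\bigcup_{s\in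 D}B_R(s)$, where $B_R(s)=s+B_R(o)$, and $\nu_\psi(A)=\int_A\psi(s)\,ds$. Draw a realization $\psi$ of $\Psi$ and, given $\psi$, draw three mutually independent sequences: $S_1,S_2,\dots$ i.i.d. on $D_R$ with probability density $\psi/\nu_\psi(D_R)$; $X_1,X_2,\dots$ i.i.d. copies of $X$; and $\xi_1,\xi_2,\dots$ i.i.d. standard exponential. Set $\Gamma_n=\sum_{i=1}^n\xi_i$, $$T=\inf\Big\{n\ge1:\ \Gamma_{n+1}^{-1}C\le\inf_{t\in D}\bigvee_{i=1}^n\Gamma_i^{-1}X_i(t-S_i)\Big\}\qquad(\inf\emptyset=\infty),$$ $$\widetilde Y(t)=\frac{\nu_\psi(D_R)}{\mu_Y}\bigvee_{i=1}^{T}\Gamma_i^{-1}X_i(t-S_i),\qquad t\in D.$$ Then: 1. The stopping time $T$ is almost surely finite. 2. The law of the process $(\widetilde Y(t))_{t\in D}$ coincides with the law of $(Y(t))_{t\in D}$. More precisely, the joint law of the intensity process and $(\widetilde Y(t))_{t\in D}$ coincides with the joint law of $\Psi$ and $(Y(t))_{t\in D}$, so that the laws also agree conditionally on $\Psi=\psi$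 for almost every realization $\psi$. -/

import Mathlib

open MeasureTheory ProbabilityTheory Set
open scoped NNReal ENNReal

noncomputable section

namespace CoxExtremal

/-- Euclidean space `ℝ^d`. -/
abbrev Pt (d : ℕ) : Type := EuclideanSpace ℝ (Fin d)

/-- Non-negative continuous functions on `ℝ^d`, with the topology of locally uniform convergence
(the compact-open topology). Sample-continuous non-negative processes on `ℝ^d` are random elements
of this space. -/
abbrev Path (d : ℕ) : Type := C(Pt d, ℝ≥0)

/-- The space of paths carries its Borel σ-algebra. -/
instance instMeasurableSpacePath (d : ℕ) : MeasurableSpace (Path d) := borel (Path d)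

instance instBorelSpacePath (d : ℕ) : BorelSpace (Path d) := ⟨rfl⟩

/-- Marked storms: centre `s`, severity `u` and shape `f`. -/
abbrev Storm (d : ℕ) : Type := Pt d × ℝ≥0∞ × Path d

/-! ### Poisson and Cox processes -/

/-- `Q`, a law on measures on `S`, is the law of a Poisson process with directing measure `lam`:
the number of points in a measurable set `B` with `lam B < ∞` is Poisson distributed with parameter
`lam B`, and the numbers of points in finitely many disjoint measurable sets are independent. -/
structure IsPoissonLaw {S : Type*} [MeasurableSpace S]
    (lam : Measure S) (Q : Measure (Measure S)) : Prop where
  isProbabilityMeasure : IsProbabilityMeasure Q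
  count_law : ∀ B : Set S, MeasurableSet B → lam B < ∞ →
    HasLaw (fun N : Measure S => N B)
      ((poissonMeasure (lam B).toNNReal).map (fun k : ℕ => (k : ℝ≥0∞))) Q
  count_indep : ∀ (n : ℕ) (B : Fin n → Set S), (∀ j, MeasurableSet (B j)) →
    Pairwise (fun j k => Disjoint (B j) (B k)) →
    iIndepFun (fun (j : Fin n) (N : Measure S) => N (B j)) Q

/-- The point process `∑ i, δ_{p i}` of a sequence of random points. -/
def pointProcess {Ω S : Type*} [MeasurableSpace S] (p : ℕ → Ω → S) (ω : Ω) : Measure S :=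
  Measure.sum (fun i => Measure.dirac (p i ω))

/-- The point process `∑ i, δ_{p i}` is a Cox process with random environment `Z` and directing
random measure `Lam Z`: conditionally on `Z = z` it is a Poisson process directed by `Lam z`. -/
structure IsCoxProcess {Ω 𝓩 S : Type*} [MeasurableSpace Ω] [MeasurableSpace 𝓩] [MeasurableSpace S]
    (P : Measure Ω) (Z : Ω → 𝓩) (Lam : 𝓩 → Measure S) (p : ℕ → Ω → S) : Prop where
  measurable_points : ∀ i, Measurable (p i)
  cond_law : ∃ κ : Kernel 𝓩 (Measure S), IsMarkovKernel κ ∧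
    HasCondDistrib (pointProcess p) Z κ P ∧
    ∀ᵐ z ∂(P.map Z), IsPoissonLaw (Lam z) (κ z)

/-! ### Cox extremal processes -/

/-- The measure `ν_ψ(A) = ∫_A ψ(s) ds` on `ℝ^d`. -/
def spatialMeasure {d : ℕ} (ψ : Path d) : Measure (Pt d) :=
  (volume : Measure (Pt d)).withDensity (fun s => (ψ s : ℝ≥0∞))

/-- The measure `u^{-2} du` on `(0,∞)`, as a measure on `[0,∞]` that gives no mass to `0`
and `∞`. -/
def severityMeasure : Measure ℝ≥0∞ :=
  (((volume : Measure ℝ).restrict (Ioi 0)).withDensity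
    (fun u => ENNReal.ofReal (u ^ (-2 : ℤ)))).map ENNReal.ofReal

/-- The measure `μ⁻¹ ψ(s) ds u^{-2} du dP_X(f)` that directs the storms given `Ψ = ψ`. -/
def stormIntensity {d : ℕ} (PX : Measure (Path d)) (μ : ℝ≥0) (ψ : Path d) : Measure (Storm d) :=
  (μ : ℝ≥0∞)⁻¹ • (spatialMeasure ψ).prod (severityMeasure.prod PX)

/-- The extremal field `t ↦ ⨆ i, u_i X_i (t - s_i)` of a sequence of storms `(s_i, u_i, X_i)`. -/
def extremalField {Ω : Type*} {d : ℕ} (p : ℕ → Ω → Storm d) (t : Pt d) (ω : Ω) : ℝ≥0∞ :=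
  ⨆ i, (p i ω).2.1 * ((p i ω).2.2 (t - (p i ω).1) : ℝ≥0∞)

/-- `Ψ` is an intensity process with law `PΨ`, and `p` enumerates the points of a Cox process of
storms with spatial intensity process `Ψ`, shape law `PX` and scaling constant `μ`. The associated
Cox extremal process is `extremalField p`. -/
structure IsCoxExtremalModel {Ω : Type*} [MeasurableSpace Ω] {d : ℕ} (P : Measure Ω)
    (PΨ PX : Measure (Path d)) (μ : ℝ≥0) (Ψ : Ω → Path d) (p : ℕ → Ω → Storm d) : Prop where
  law_intensity : HasLaw Ψ PΨ P
  cox : IsCoxProcess P Ψ (stormIntensity PX μ) p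

/-! ### The simulation algorithm -/

/-- The enlarged region `D_R = D ⊕ B_R(o) = ⋃_{s ∈ D} B_R(s)`. -/
def enlarge {d : ℕ} (D : Set (Pt d)) (R : ℝ) : Set (Pt d) :=
  ⋃ s ∈ D, Metric.closedBall s R

/-- The measure `ψ(s) ds / ν_ψ(A)` on `A`. -/
def centreLaw {d : ℕ} (A : Set (Pt d)) (ψ : Path d) : Measure (Pt d) :=
  (spatialMeasure ψ A)⁻¹ • (spatialMeasure ψ).restrict A

/-- The random input of the algorithm (sequences are indexed from `0`): `Ψ` has law `PΨ` and,
given `Ψ = ψ`, the sequences `(S i)`, `(X i)`, `(ξ i)` are independent of each other, and each is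
i.i.d., with laws `ψ / ν_ψ(A)` on `A`, `PX` and the standard exponential law respectively. -/
structure IsSimulationInput {Ω : Type*} [MeasurableSpace Ω] {d : ℕ} (P : Measure Ω)
    (PΨ PX : Measure (Path d)) (A : Set (Pt d))
    (Ψ : Ω → Path d) (S : ℕ → Ω → Pt d) (X : ℕ → Ω → Path d) (ξ : ℕ → Ω → ℝ) : Prop where
  law_intensity : HasLaw Ψ PΨ P
  cond_law : ∃ κ : Kernel (Path d) ((ℕ → Pt d) × (ℕ → Path d) × (ℕ → ℝ)), IsMarkovKernel κ ∧
    HasCondDistrib (fun ω => (fun i => S i ω, fun i => X i ω, fun i => ξ i ω)) Ψ κ P ∧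
    ∀ᵐ ψ ∂PΨ, κ ψ = (Measure.infinitePi (fun _ : ℕ => centreLaw A ψ)).prod
      ((Measure.infinitePi (fun _ : ℕ => PX)).prod
        (Measure.infinitePi (fun _ : ℕ => expMeasure 1)))

/-- The arrival times `Γ_n = ξ_1 + ⋯ + ξ_n`. -/
def arrival {Ω : Type*} (ξ : ℕ → Ω → ℝ) (n : ℕ) (ω : Ω) : ℝ :=
  ∑ i ∈ Finset.range n, ξ i ω

/-- The `i`-th term `Γ_i^{-1} X_i (t - S_i)`; since sequences are indexed from `0`, the index `i`
here stands for the `(i+1)`-st storm. -/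
def simTerm {Ω : Type*} {d : ℕ} (S : ℕ → Ω → Pt d) (X : ℕ → Ω → Path d) (ξ : ℕ → Ω → ℝ)
    (i : ℕ) (t : Pt d) (ω : Ω) : ℝ≥0∞ :=
  (ENNReal.ofReal (arrival ξ (i + 1) ω))⁻¹ * (X i ω (t - S i ω) : ℝ≥0∞)

/-- The stopping time
`T = inf {n ≥ 1 : Γ_{n+1}^{-1} C ≤ inf_{t ∈ D} max_{1 ≤ i ≤ n} Γ_i^{-1} X_i (t - S_i)}`,
with `inf ∅ = ∞`. -/
def stopIndex {Ω : Type*} {d : ℕ} (D : Set (Pt d)) (C : ℝ≥0)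
    (S : ℕ → Ω → Pt d) (X : ℕ → Ω → Path d) (ξ : ℕ → Ω → ℝ) (ω : Ω) : ℕ∞ :=
  sInf {m : ℕ∞ | ∃ n : ℕ, m = n ∧ 1 ≤ n ∧
    (ENNReal.ofReal (arrival ξ (n + 1) ω))⁻¹ * (C : ℝ≥0∞) ≤
      ⨅ t ∈ D, ⨆ i ∈ Finset.range n, simTerm S X ξ i t ω}

/-- The simulated field
`Ỹ(t) = ν_ψ(D_R) / μ * max_{1 ≤ i ≤ T} Γ_i^{-1} X_i (t - S_i)`, where `ψ = Ψ ω`. -/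
def simField {Ω : Type*} {d : ℕ} (D : Set (Pt d)) (R : ℝ) (C μ : ℝ≥0) (Ψ : Ω → Path d)
    (S : ℕ → Ω → Pt d) (X : ℕ → Ω → Path d) (ξ : ℕ → Ω → ℝ) (t : Pt d) (ω : Ω) : ℝ≥0∞ :=
  spatialMeasure (Ψ ω) (enlarge D R) / (μ : ℝ≥0∞) *
    ⨆ (i : ℕ) (_ : (i : ℕ∞) < stopIndex D C S X ξ ω), simTerm S X ξ i t ω

end CoxExtremal

end

/-! The law of a field on `D`, jointly with the intensity, is determined by the probabilities that
the intensity lies in a given set and the field stays below positive thresholds `y` at finitely many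
sites `J` (`ext_of_prod_Iic`). Call `score` the largest ratio of a shape placed at its centre to the
thresholds. A storm of severity `u` respects all thresholds exactly when `u * score ≤ 1`, so each
side becomes a statement about one scalar per storm.

For the Cox process, respecting the thresholds means having no point in `exceedance`. Given `ψ`,
this has probability `exp (-Λ)`, where `Λ` is the directing measure of that set. Since `u⁻² du`
gives mass `g` to `{u | 1 < u * g}`, `Λ` is `ν_ψ(D_R) / μ` times the mean score of a random centre
in `D_R` with a random shape (`stormIntensity_exceedance`).

For the simulation without stopping, the condition reads `H_i ≤ Γ_i` for all `i`, with `H = ν_ψ(D_R)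
/ μ * score` evaluated on i.i.d. marks. Its probability is `exp (-E H)`
(`infinitePi_belowArrivals`), proved without constructing a Poisson process: shifting the arrival
times by `x` gives a function that solves a renewal equation, hence a linear differential equation.
The two exponents agree.

Stopping changes nothing on `D`, because a storm after time `T` is bounded by `C / Γ_{T+1}`, which
the field already dominates. `T` is finite because finitely many storms almost surely cover `D` by
compactness, while `Γ_n → ∞`. -/

namespace CoxExtremal

open Filter Topology

/-! ### I.i.d. sequences as infinite product measures. -/

section ProductMeasures

/-- Square cylinders whose sides come from generating families generate the product σ-algebra. -/
theorem generateFrom_squareCylinders_generateFrom {ι : Type*} {α : ι → Type*}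
    [m : ∀ i, MeasurableSpace (α i)] (C : ∀ i, Set (Set (α i)))
    (hC : ∀ i, MeasurableSpace.generateFrom (C i) = m i) (huniv : ∀ i, univ ∈ C i) :
    MeasurableSpace.generateFrom (squareCylinders C) = MeasurableSpace.pi := by
  apply le_antisymm
  · rw [MeasurableSpace.generateFrom_le_iff]
    rintro S ⟨s, t, h, rfl⟩
    refine MeasurableSet.pi (Finset.countable_toSet _) (fun i _ => ?_)
    rw [← hC i]
    exact MeasurableSpace.measurableSet_generateFrom (h i (mem_univ i))
  · refine iSup_le fun i => ?_
    rw [← hC i, MeasurableSpace.comap_generateFrom]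
    refine MeasurableSpace.generateFrom_mono ?_
    rintro _ ⟨u, hu, rfl⟩
    classical
    refine ⟨{i}, Function.update (fun _ => univ) i u, ?_, ?_⟩
    · intro j _
      by_cases hj : j = i
      · subst hj; simpa using hu
      · simpa [hj] using huniv j
    · ext x; simp

/-- Finite measures on a product space agree when they agree on boxes with finitely many
constrained sides taken from generating π-systems. -/
theorem ext_of_squareCylinders {ι : Type*} {α : ι → Type*}
    [m : ∀ i, MeasurableSpace (α i)] (C : ∀ i, Set (Set (α i)))
    (hC : ∀ i, MeasurableSpace.generateFrom (C i) = m i) (huniv : ∀ i, univ ∈ C i)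
    (hpi : ∀ i, IsPiSystem (C i)) {ρ σ : Measure (∀ i, α i)} [IsFiniteMeasure ρ]
    (h : ∀ (s : Finset ι) (t : ∀ i, Set (α i)), (∀ i, t i ∈ C i) →
      ρ ((s : Set ι).pi t) = σ ((s : Set ι).pi t)) : ρ = σ := by
  refine ext_of_generate_finite _ (generateFrom_squareCylinders_generateFrom C hC huniv).symm
    (isPiSystem_squareCylinders hpi huniv) ?_ ?_
  · rintro _ ⟨s, t, ht, rfl⟩
    exact h s t fun i => ht i (mem_univ i)
  · simpa using h ∅ (fun _ => univ) huniv

variable {E F : Type*} [MeasurableSpace E] [MeasurableSpace F]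

/-- Two independent i.i.d. sequences form an i.i.d. sequence of pairs. -/
theorem map_zip_infinitePi (a : Measure E) (b : Measure F) [IsProbabilityMeasure a]
    [IsProbabilityMeasure b] :
    ((Measure.infinitePi fun _ : ℕ => a).prod (Measure.infinitePi fun _ : ℕ => b)).map
      (fun w i => (w.1 i, w.2 i)) = Measure.infinitePi fun _ : ℕ => a.prod b := by
  have hm : Measurable fun (w : (ℕ → E) × (ℕ → F)) (i : ℕ) => (w.1 i, w.2 i) := by fun_prop
  have := Measure.isProbabilityMeasure_map (μ := (Measure.infinitePi fun _ : ℕ => a).prod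
    (Measure.infinitePi fun _ : ℕ => b)) hm.aemeasurable
  refine ext_of_squareCylinders
    (fun _ => image2 (· ×ˢ ·) {s : Set E | MeasurableSet s} {t : Set F | MeasurableSet t})
    (fun _ => generateFrom_prod) (fun _ => ⟨univ, .univ, univ, .univ, univ_prod_univ⟩)
    (fun _ => isPiSystem_prod) fun s t ht => ?_
  choose u hu v hv huv using ht
  obtain rfl : (fun i => u i ×ˢ v i) = t := funext huv
  rw [Measure.map_apply hm (MeasurableSet.pi (Finset.countable_toSet _)
      fun i _ => (hu i).prod (hv i)), Measure.infinitePi_pi _ fun i _ => (hu i).prod (hv i)]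
  have : (fun (w : (ℕ → E) × (ℕ → F)) (i : ℕ) => (w.1 i, w.2 i)) ⁻¹'
      ((s : Set ℕ).pi fun i => u i ×ˢ v i) = ((s : Set ℕ).pi u) ×ˢ ((s : Set ℕ).pi v) := by
    ext w
    simp only [mem_preimage, Set.mem_pi, mem_prod]
    exact ⟨fun h => ⟨fun i hi => (h i hi).1, fun i hi => (h i hi).2⟩,
      fun h i hi => ⟨h.1 i hi, h.2 i hi⟩⟩
  rw [this, Measure.prod_prod, Measure.infinitePi_pi _ fun i _ => hu i,
    Measure.infinitePi_pi _ fun i _ => hv i, ← Finset.prod_mul_distrib]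
  simp only [Measure.prod_prod]

/-- Prepend a first element to a sequence. -/
def consSeq (w : E × (ℕ → E)) : ℕ → E := fun n => Nat.casesOn n w.1 w.2

theorem measurable_consSeq : Measurable (consSeq (E := E)) := by
  refine measurable_pi_iff.2 fun n => ?_
  cases n with
  | zero => exact measurable_fst
  | succ n => exact (measurable_pi_apply n).comp measurable_snd

/-- Allows an i.i.d. sequence to be split into its first element and an independent copy of itself,
as a first-step analysis requires. -/
theorem map_consSeq_infinitePi (a : Measure E) [IsProbabilityMeasure a] :
    (a.prod (Measure.infinitePi fun _ : ℕ => a)).map consSeq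
      = Measure.infinitePi fun _ : ℕ => a := by
  refine Measure.eq_infinitePi _ fun s t ht => ?_
  classical
  rw [Measure.map_apply measurable_consSeq (MeasurableSet.pi (Finset.countable_toSet _)
      fun i _ => ht i)]
  let s' : Finset ℕ := s.preimage Nat.succ (Nat.succ_injective.injOn)
  -- The box constrains the first coordinate only when `0 ∈ s`; all other constraints shift down by
  -- one.
  let t0 : Set E := if 0 ∈ s then t 0 else univ
  have ht0 : MeasurableSet t0 := by dsimp only [t0]; split_ifs; exacts [ht 0, .univ]
  have : consSeq ⁻¹' ((s : Set ℕ).pi t) = t0 ×ˢ ((s' : Set ℕ).pi fun i => t (i + 1)) := by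
    ext w
    simp only [mem_preimage, Set.mem_pi, mem_prod, t0, s', Finset.coe_preimage, Finset.mem_coe]
    constructor
    · intro h
      refine ⟨?_, fun i hi => h (i + 1) hi⟩
      split_ifs with h0
      · exact h 0 h0
      · trivial
    · rintro ⟨h0, h1⟩ (_ | i) hi
      · rw [if_pos hi] at h0; exact h0
      · exact h1 i hi
  rw [this, Measure.prod_prod, Measure.infinitePi_pi _ fun i _ => ht (i + 1)]
  have h1 : ∏ i ∈ s', a (t (i + 1)) = ∏ i ∈ s.erase 0, a (t i) := by
    refine Finset.prod_bij (fun i _ => i + 1) ?_ ?_ ?_ ?_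
    · intro i hi; simpa [s'] using hi
    · intro i _ j _ h; simpa using h
    · rintro (_ | i) hi
      · simp at hi
      · exact ⟨i, by simpa [s'] using hi, rfl⟩
    · intros; rfl
  rw [h1]
  by_cases h0 : 0 ∈ s
  · rw [← Finset.mul_prod_erase s _ h0]; simp [t0, h0]
  · rw [Finset.erase_eq_of_notMem h0]; simp [t0, h0]

theorem ae_forall_mem_infinitePi {a : Measure E} [IsProbabilityMeasure a] {p : E → Prop}
    (h : ∀ᵐ x ∂a, p x) : ∀ᵐ z ∂(Measure.infinitePi fun _ : ℕ => a), ∀ i, p (z i) :=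
  ae_all_iff.2 fun i =>
    (measurePreserving_eval_infinitePi (fun _ : ℕ => a) i).quasiMeasurePreserving.ae h

/-- In an i.i.d. sequence an event of positive probability occurs infinitely often. -/
theorem ae_frequently_mem_infinitePi {a : Measure E} [IsProbabilityMeasure a] {A : Set E}
    (hA : MeasurableSet A) (hpos : a A ≠ 0) :
    ∀ᵐ z ∂(Measure.infinitePi fun _ : ℕ => a), ∃ᶠ i in atTop, z i ∈ A := by
  set s : ℕ → Set (ℕ → E) := fun i => (fun z => z i) ⁻¹' A
  have hs : ∀ i, MeasurableSet (s i) := fun i => measurable_pi_apply i hA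
  have hsA : ∀ i, (Measure.infinitePi fun _ : ℕ => a) (s i) = a A := fun i =>
    (measurePreserving_eval_infinitePi (fun _ : ℕ => a) i).measure_preimage hA.nullMeasurableSet
  have hind : iIndepSet s (Measure.infinitePi fun _ : ℕ => a) := by
    have h := iIndepFun_infinitePi (P := fun _ : ℕ => a) (X := fun _ x => x)
      (fun _ => measurable_id)
    rw [iIndepSet_iff_meas_biInter hs]
    intro t
    exact (h.measure_inter_preimage_eq_mul t (sets := fun _ => A) fun i _ => hA)
  -- Second Borel–Cantelli lemma: the events are independent with constant nonzero probability, so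
  -- their probabilities sum to infinity.
  have h1 := measure_limsup_eq_one hs hind (by simp [hsA, ENNReal.tsum_const_eq_top_of_ne_zero hpos])
  have hm : MeasurableSet (limsup s atTop) := MeasurableSet.measurableSet_limsup hs
  have := (prob_compl_eq_zero_iff hm).2 h1
  rw [← mem_ae_iff] at this
  filter_upwards [this] with z hz
  rwa [mem_limsup_iff_frequently_mem] at hz

end ProductMeasures

/-! ### The standard exponential law. -/

instance : IsProbabilityMeasure (expMeasure 1) := isProbabilityMeasure_expMeasure one_pos

theorem ae_pos_expMeasure : ∀ᵐ v ∂(expMeasure 1), 0 < v := by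
  have h : expMeasure 1 (Iic 0) = 0 := by
    rw [← ofReal_cdf, cdf_expMeasure_eq one_pos]; simp
  rw [ae_iff]
  simpa [Iic] using h

theorem expMeasure_Ici_ne_zero (x : ℝ) : expMeasure 1 (Ici x) ≠ 0 := by
  intro h
  have h1 : expMeasure 1 (Iio x) = 1 := by
    rw [← prob_compl_eq_zero_iff measurableSet_Iio, compl_Iio]; exact h
  have h2 : expMeasure 1 (Iic x) = 1 :=
    le_antisymm prob_le_one (h1 ▸ measure_mono Iio_subset_Iic_self)
  rw [← ofReal_cdf, cdf_expMeasure_eq one_pos] at h2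
  have h3 : (if 0 ≤ x then 1 - Real.exp (-(1 * x)) else 0) < 1 := by
    split_ifs
    · have := Real.exp_pos (-(1 * x)); linarith
    · exact one_pos
  have := (ENNReal.ofReal_lt_one).2 h3
  exact this.ne h2

theorem integral_expMeasure (g : ℝ → ℝ) :
    ∫ v, g v ∂(expMeasure 1) = ∫ v in Ioi 0, Real.exp (-v) * g v := by
  have : expMeasure 1 = volume.withDensity (exponentialPDF 1) := rfl
  rw [this, integral_withDensity_eq_integral_toReal_smul
    (f := exponentialPDF 1) (measurable_exponentialPDFReal 1).ennreal_ofReal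
    (ae_of_all _ fun _ => ENNReal.ofReal_lt_top), ← integral_indicator measurableSet_Ioi]
  refine integral_congr_ae ?_
  filter_upwards [compl_mem_ae_iff.2 (measure_singleton (0 : ℝ))] with v hv
  have hv : v ≠ 0 := hv
  rw [exponentialPDF_eq]
  rcases lt_or_gt_of_ne hv with h | h
  · simp [h.not_ge, h.not_gt, indicator]
  · simp [h.le, h, indicator, Real.exp_nonneg]

/-! ### Probability that i.i.d. marks stay below the arrival times of a unit rate Poisson process.
-/

section Thinning

/-- The event that all marks of a marked Poisson process stay below the (shifted) arrival times. -/
def belowArrivals {E : Type*} (H : E → ℝ) (x : ℝ) : Set (ℕ → E × ℝ) :=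
  {z | ∀ i, H (z i).1 ≤ x + ∑ k ∈ Finset.range (i + 1), (z k).2}

variable {E : Type*} [MeasurableSpace E] {H : E → ℝ} (Q : Measure E)

theorem measurableSet_belowArrivals_prod (hH : Measurable H) :
    MeasurableSet {p : ℝ × (ℕ → E × ℝ) | p.2 ∈ belowArrivals H p.1} := by
  have : {p : ℝ × (ℕ → E × ℝ) | p.2 ∈ belowArrivals H p.1} =
      ⋂ i, {p | H (p.2 i).1 ≤ p.1 + ∑ k ∈ Finset.range (i + 1), (p.2 k).2} := by
    ext p; simp [belowArrivals]
  rw [this]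
  refine MeasurableSet.iInter fun i => measurableSet_le (f := fun p : ℝ × (ℕ → E × ℝ) =>
    H (p.2 i).1) (g := fun p => p.1 + ∑ k ∈ Finset.range (i + 1), (p.2 k).2) ?_ ?_
  · fun_prop
  · fun_prop

theorem measurableSet_belowArrivals (hH : Measurable H) (x : ℝ) : MeasurableSet (belowArrivals H x) :=
  (measurableSet_belowArrivals_prod hH).preimage (measurable_const.prodMk measurable_id)

theorem consSeq_mem_belowArrivals {E : Type*} {H : E → ℝ} (x : ℝ) (w : (E × ℝ) × (ℕ → E × ℝ)) :
    consSeq w ∈ belowArrivals H x ↔ H w.1.1 ≤ x + w.1.2 ∧ w.2 ∈ belowArrivals H (x + w.1.2) := by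
  constructor
  · intro h
    refine ⟨by simpa [consSeq] using h 0, fun i => ?_⟩
    have := h (i + 1)
    rw [Finset.sum_range_succ'] at this
    change H (w.2 i).1 ≤ x + (∑ k ∈ Finset.range (i + 1), (w.2 k).2 + w.1.2) at this
    linarith
  · rintro ⟨h0, h⟩ (_ | i)
    · simpa [consSeq] using h0
    · rw [Finset.sum_range_succ']
      have := h i
      change H (w.2 i).1 ≤ x + (∑ k ∈ Finset.range (i + 1), (w.2 k).2 + w.1.2)
      linarith

variable (H) in
/-- The probability that all marks stay below the arrival times shifted by `x`. -/
noncomputable def belowProb (x : ℝ) : ℝ :=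
  (Measure.infinitePi fun _ : ℕ => Q.prod (expMeasure 1)).real (belowArrivals H x)

variable (H) in
theorem monotone_belowProb [IsProbabilityMeasure Q] : Monotone (belowProb H Q) := fun x y hxy =>
  measureReal_mono fun z hz i => (hz i).trans (by linarith)

theorem belowProb_nonneg (x : ℝ) : 0 ≤ belowProb H Q x := measureReal_nonneg

theorem belowProb_le_one [IsProbabilityMeasure Q] (x : ℝ) : belowProb H Q x ≤ 1 := measureReal_le_one

/-- Renewal equation, from conditioning on the first pair: if the first waiting time is `v`, the
first mark must be at most `x + v`, and the remaining pairs face the same problem with shift `x +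
v`. -/
theorem belowProb_eq_integral (hH : Measurable H) (Q : Measure E)
    [IsProbabilityMeasure Q] (x : ℝ) :
    belowProb H Q x = ∫ v, cdf (Q.map H) (x + v) * belowProb H Q (x + v) ∂(expMeasure 1) := by
  have := Measure.isProbabilityMeasure_map (μ := Q) hH.aemeasurable
  set I := Measure.infinitePi fun _ : ℕ => Q.prod (expMeasure 1) with hI
  have key : I (belowArrivals H x) = ∫⁻ v, ENNReal.ofReal
      (cdf (Q.map H) (x + v) * belowProb H Q (x + v)) ∂(expMeasure 1) := by
    rw [hI, ← map_consSeq_infinitePi, Measure.map_apply measurable_consSeq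
      (measurableSet_belowArrivals hH x)]
    have hpre : consSeq ⁻¹' belowArrivals H x = {w : (E × ℝ) × (ℕ → E × ℝ) |
        H w.1.1 ≤ x + w.1.2 ∧ w.2 ∈ belowArrivals H (x + w.1.2)} := by
      ext w; exact consSeq_mem_belowArrivals x w
    have hmeas : MeasurableSet {w : (E × ℝ) × (ℕ → E × ℝ) |
        H w.1.1 ≤ x + w.1.2 ∧ w.2 ∈ belowArrivals H (x + w.1.2)} :=
      hpre ▸ measurable_consSeq (measurableSet_belowArrivals hH x)
    rw [hpre, Measure.prod_apply hmeas, lintegral_prod_symm _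
      (measurable_measure_prodMk_left hmeas).aemeasurable]
    refine lintegral_congr fun v => ?_
    have h1 : ∀ w : E, I (Prod.mk (w, v) ⁻¹' {w : (E × ℝ) × (ℕ → E × ℝ) |
        H w.1.1 ≤ x + w.1.2 ∧ w.2 ∈ belowArrivals H (x + w.1.2)}) =
        (H ⁻¹' Iic (x + v)).indicator (fun _ => I (belowArrivals H (x + v))) w := by
      intro w
      by_cases hw : H w ≤ x + v
      · rw [indicator_of_mem (by exact hw)]
        congr 1; ext z; simp [hw]
      · rw [indicator_of_notMem (by exact hw)]
        convert measure_empty (μ := I) using 2; ext z; simp [hw]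
    rw [lintegral_congr h1, lintegral_indicator_const (hH measurableSet_Iic),
      ENNReal.ofReal_mul (cdf_nonneg _ _), ofReal_cdf, Measure.map_apply hH measurableSet_Iic,
      belowProb, ofReal_measureReal, mul_comm]
  have hmeas : Measurable fun v => cdf (Q.map H) (x + v) * belowProb H Q (x + v) :=
    (((monotone_cdf _).measurable.comp (measurable_const_add x))).mul
      ((monotone_belowProb H Q).measurable.comp (measurable_const_add x))
  rw [belowProb, measureReal_def, key, integral_eq_lintegral_of_nonneg_ae
    (ae_of_all _ fun v => mul_nonneg (cdf_nonneg _ _) (belowProb_nonneg Q _))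
    hmeas.aestronglyMeasurable]

/-- The integrand of the integral equation solved by `belowProb`. -/
noncomputable def belowDensity (H : E → ℝ) (Q : Measure E) (v : ℝ) : ℝ :=
  Real.exp (-v) * (cdf (Q.map H) v * belowProb H Q v)

theorem measurable_belowDensity [IsProbabilityMeasure Q] : Measurable (belowDensity H Q) :=
  (Real.measurable_exp.comp measurable_neg).mul
    ((monotone_cdf _).measurable.mul (monotone_belowProb H Q).measurable)

theorem integrableOn_belowDensity [IsProbabilityMeasure Q] (a : ℝ) : IntegrableOn (belowDensity H Q) (Ioi a) := by
  refine Integrable.mono' (integrableOn_exp_neg_Ioi a)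
    (measurable_belowDensity Q).aestronglyMeasurable (ae_of_all _ fun v => ?_)
  have h0 := mul_nonneg (cdf_nonneg (Q.map H) v) (belowProb_nonneg (H := H) Q v)
  rw [belowDensity, Real.norm_of_nonneg (mul_nonneg (Real.exp_nonneg _) h0)]
  exact mul_le_of_le_one_right (Real.exp_nonneg _)
    (mul_le_one₀ (cdf_le_one _ _) (belowProb_nonneg Q v) (belowProb_le_one Q v))

/-- Translating by `x` turns the renewal equation into `exp x` times the integral of `belowDensity`
over `(x, ∞)`. Splitting this tail at `0` puts the dependence on `x` into a primitive, which yields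
continuity and then differentiability. -/
theorem belowProb_eq_exp_mul (hH : Measurable H) (Q : Measure E)
    [IsProbabilityMeasure Q] (x : ℝ) : belowProb H Q x =
    Real.exp x * ((∫ v in Ioi 0, belowDensity H Q v) - ∫ v in 0..x, belowDensity H Q v) := by
  rw [← intervalIntegral.integral_Ioi_sub_Ioi' (integrableOn_belowDensity Q 0)
    (integrableOn_belowDensity Q x), sub_sub_cancel, belowProb_eq_integral hH Q,
    integral_expMeasure, ← integral_const_mul,
    ← integral_indicator measurableSet_Ioi, ← integral_indicator measurableSet_Ioi,
    ← integral_add_left_eq_self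
      ((Ioi x).indicator fun v => Real.exp x * belowDensity H Q v) x]
  refine integral_congr_ae (ae_of_all _ fun v => ?_)
  by_cases hv : 0 < v
  · simp only [indicator, mem_Ioi, hv, if_true, lt_add_iff_pos_right, belowDensity]
    rw [← mul_assoc, ← mul_assoc, ← mul_assoc, ← Real.exp_add]
    rw [show x + -(x + v) = -v by ring, mul_assoc]
  · simp [indicator, hv]

theorem intervalIntegrable_belowDensity [IsProbabilityMeasure Q] (a b : ℝ) :
    IntervalIntegrable (belowDensity H Q) volume a b := by
  rw [intervalIntegrable_iff]
  exact (integrableOn_belowDensity Q (min a b)).mono_set Ioc_subset_Ioi_self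

theorem continuous_belowProb (hH : Measurable H) (Q : Measure E)
    [IsProbabilityMeasure Q] : Continuous (belowProb H Q) := by
  have h := intervalIntegral.continuous_primitive (μ := volume)
    (intervalIntegrable_belowDensity (H := H) Q) 0
  rw [funext (belowProb_eq_exp_mul hH Q)]
  fun_prop

theorem cdf_continuousWithinAt (ρ : Measure ℝ) (x : ℝ) :
    ContinuousWithinAt (cdf ρ) (Ioi x) x :=
  ((cdf ρ).right_continuous x).mono Ioi_subset_Ici_self

/-- Differentiating `exp x` reproduces the function, and differentiating the primitive contributes
`-cdf` times it. The derivative is one-sided because a distribution function is in general only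
right-continuous. -/
theorem hasDerivWithinAt_belowProb (hH : Measurable H) (Q : Measure E)
    [IsProbabilityMeasure Q] (x : ℝ) :
    HasDerivWithinAt (belowProb H Q) ((1 - cdf (Q.map H) x) * belowProb H Q x) (Ici x) x := by
  have hF : ContinuousWithinAt (belowDensity H Q) (Ioi x) x :=
    (Real.continuous_exp.comp continuous_neg).continuousWithinAt.mul
      ((cdf_continuousWithinAt _ x).mul (continuous_belowProb hH Q).continuousWithinAt)
  have h1 : HasDerivWithinAt (fun u => ∫ v in 0..u, belowDensity H Q v)
      (belowDensity H Q x) (Ici x) x :=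
    intervalIntegral.integral_hasDerivWithinAt_right (intervalIntegrable_belowDensity Q 0 x)
      (measurable_belowDensity Q).stronglyMeasurable.stronglyMeasurableAtFilter hF
  have h2 := ((Real.hasDerivAt_exp x).hasDerivWithinAt (s := Ici x)).mul
    (h1.const_sub (∫ v in Ioi 0, belowDensity H Q v))
  refine (h2.congr_of_mem (fun y _ => belowProb_eq_exp_mul hH Q y) self_mem_Ici).congr_deriv ?_
  rw [← belowProb_eq_exp_mul hH Q, belowDensity, mul_neg, ← mul_assoc, ← Real.exp_add,
    add_neg_cancel, Real.exp_zero]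
  ring

/-- All marks of a marked unit rate Poisson process on the half-line stay below the arrival times
with probability `exp (-E H)`. -/
theorem infinitePi_belowArrivals (hH : Measurable H) [IsProbabilityMeasure Q] {M : ℝ} (hM : 0 ≤ M) (h0 : ∀ᵐ w ∂Q, 0 ≤ H w)
    (hHM : ∀ᵐ w ∂Q, H w ≤ M) :
    (Measure.infinitePi fun _ : ℕ => Q.prod (expMeasure 1)) (belowArrivals H 0)
      = ENNReal.ofReal (Real.exp (-∫ w, H w ∂Q)) := by
  have := Measure.isProbabilityMeasure_map (μ := Q) hH.aemeasurable
  set G := cdf (Q.map H) with hG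
  have hGi : ∀ a b, IntervalIntegrable (fun v => 1 - G v) volume a b := fun a b =>
    intervalIntegrable_const.sub (monotone_cdf _).intervalIntegrable
  have hcont : Continuous fun x => belowProb H Q x * Real.exp (-∫ v in 0..x, (1 - G v)) := by
    have h1 := continuous_belowProb hH Q
    have h2 := intervalIntegral.continuous_primitive (μ := volume) hGi 0
    fun_prop
  -- The integrating factor `exp (-∫ (1 - G))` makes the right derivative of the product vanish, so
  -- its values at `0` and `M` coincide.
  have hconst := constant_of_has_deriv_right_zero (a := 0) (b := M) hcont.continuousOn
    (fun x _ => by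
      have h1 : HasDerivWithinAt (fun u => ∫ v in 0..u, (1 - G v)) (1 - G x) (Ici x) x :=
        intervalIntegral.integral_hasDerivWithinAt_right (hGi 0 x)
          (measurable_const.sub
            (monotone_cdf _).measurable).stronglyMeasurable.stronglyMeasurableAtFilter
          (continuousWithinAt_const.sub (cdf_continuousWithinAt _ x))
      refine ((hasDerivWithinAt_belowProb hH Q x).mul h1.neg.exp).congr_deriv ?_
      ring) M ⟨hM, le_rfl⟩
  -- Boundary value: a shift by `M` already dominates every mark.
  have hone : belowProb H Q M = 1 := by
    rw [belowProb, measureReal_def, (prob_compl_eq_zero_iff (measurableSet_belowArrivals hH M)).1,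
      ENNReal.toReal_one]
    rw [← mem_ae_iff]
    have hae : ∀ᵐ p ∂(Q.prod (expMeasure 1)), H p.1 ≤ M ∧ 0 < p.2 :=
      (Measure.quasiMeasurePreserving_fst.ae hHM).and
        (Measure.quasiMeasurePreserving_snd.ae ae_pos_expMeasure)
    filter_upwards [ae_forall_mem_infinitePi hae] with z hz i
    have : 0 ≤ ∑ k ∈ Finset.range (i + 1), (z k).2 :=
      Finset.sum_nonneg fun k _ => (hz k).2.le
    linarith [(hz i).1]
  have hint : Integrable H Q := by
    refine Integrable.of_bound hH.aestronglyMeasurable M ?_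
    filter_upwards [h0, hHM] with w h1 h2
    rwa [Real.norm_of_nonneg h1]
  -- Layer-cake formula; the tail probability vanishes beyond the bound `M`.
  have hlayer : ∫ w, H w ∂Q = ∫ v in 0..M, (1 - G v) := by
    rw [hint.integral_eq_integral_meas_lt h0, intervalIntegral.integral_of_le hM]
    have hval : ∀ v, Q.real {w | v < H w} = 1 - G v := fun v => by
      rw [hG, cdf_eq_real, map_measureReal_apply hH measurableSet_Iic, ← probReal_compl_eq_one_sub
        (hH measurableSet_Iic)]
      congr 1; ext w; simp
    simp only [hval]
    refine setIntegral_eq_of_subset_of_forall_sdiff_eq_zero measurableSet_Ioi Ioc_subset_Ioi_self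
      fun v hv => ?_
    rw [← hval, measureReal_def, ENNReal.toReal_eq_zero_iff]
    left
    refine measure_mono_null (fun w (hw : v < H w) => ?_) (ae_iff.1 hHM)
    have : M < v := by
      by_contra h
      exact hv.2 ⟨hv.1, not_lt.1 h⟩
    exact fun h => (hw.trans_le h).not_gt this
  rw [hone, one_mul, ← hlayer] at hconst
  rw [intervalIntegral.integral_same, neg_zero, Real.exp_zero, mul_one] at hconst
  rw [hconst, belowProb, ofReal_measureReal]

end Thinning

variable {d : ℕ}

/-! ### Reduction of finitely many thresholds to one scalar per storm. -/

section Score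

@[fun_prop]
theorem measurable_shape_apply {Ω : Type*} [MeasurableSpace Ω] {s : Ω → Pt d} {f : Ω → Path d}
    (hs : Measurable s) (hf : Measurable f) (t : Pt d) :
    Measurable fun ω => f ω (t - s ω) := by
  have h : Continuous fun w : Pt d × Path d => w.2 (t - w.1) := by fun_prop
  exact h.measurable.comp (hs.prodMk hf)

/-- The largest ratio of a shape `f` centred at `s` to the thresholds `y` at the sites `J`. -/
noncomputable def score {D : Set (Pt d)} (J : Finset D) (y : D → ℝ≥0∞)
    (w : Pt d × Path d) : ℝ≥0∞ :=
  ⨆ t ∈ J, (w.2 ((t : Pt d) - w.1) : ℝ≥0∞) / y t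

variable {D : Set (Pt d)} {J : Finset D} {y : D → ℝ≥0∞}

theorem measurable_score (J : Finset D) (y : D → ℝ≥0∞) : Measurable (score J y) := by
  refine Measurable.biSup (J : Set D) (Finset.countable_toSet J) fun t _ => ?_
  exact (measurable_shape_apply measurable_fst measurable_snd _).coe_nnreal_ennreal.div_const _

theorem mul_le_iff_mul_div_le_one {u a b : ℝ≥0∞} (hb : b ≠ 0) :
    u * a ≤ b ↔ u * (a / b) ≤ 1 := by
  rcases eq_or_ne b ∞ with rfl | hb'
  · simp
  · rw [← mul_div_assoc, ENNReal.div_le_iff hb hb', one_mul]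

theorem mul_score_le_one_iff (hy : ∀ t, y t ≠ 0) (u : ℝ≥0∞) (w : Pt d × Path d) :
    u * score J y w ≤ 1 ↔ ∀ t ∈ J, u * (w.2 ((t : Pt d) - w.1) : ℝ≥0∞) ≤ y t := by
  simp only [score, ENNReal.mul_iSup, iSup_le_iff]
  exact forall₂_congr fun t _ => (mul_le_iff_mul_div_le_one (hy t)).symm

/-- The largest possible score of a shape bounded by `C`. -/
noncomputable def scoreBound (J : Finset D) (y : D → ℝ≥0∞) (C : ℝ≥0) : ℝ≥0∞ :=
  ⨆ t ∈ J, (C : ℝ≥0∞) / y t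

theorem scoreBound_lt_top (hy : ∀ t, y t ≠ 0) (C : ℝ≥0) : scoreBound J y C < ∞ := by
  rw [scoreBound, ← Finset.sup_eq_iSup, Finset.sup_lt_iff (by simp)]
  exact fun t _ => ENNReal.div_lt_top ENNReal.coe_ne_top (hy t)

theorem score_le_scoreBound {C : ℝ≥0} {w : Pt d × Path d} (h : ∀ s, w.2 s ≤ C) :
    score J y w ≤ scoreBound J y C :=
  iSup₂_mono fun _ _ => ENNReal.div_le_div_right (ENNReal.coe_le_coe.2 (h _)) _

/-- A centre outside `D_R` is at distance more than `R` from every site of `D`, so the shape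
vanishes at those sites. Hence drawing centres only in `D_R` loses nothing. -/
theorem score_eq_zero_of_notMem_enlarge {R : ℝ} {C : ℝ≥0} {w : Pt d × Path d}
    (h : ∀ s, w.2 s ≤ (Metric.closedBall 0 R).indicator (fun _ => C) s)
    (hw : w.1 ∉ enlarge D R) : score J y w = 0 := by
  simp only [score, ENNReal.iSup_eq_zero]
  intro t _
  have ht : (t : Pt d) - w.1 ∉ Metric.closedBall (0 : Pt d) R := by
    intro ht
    refine hw (mem_biUnion t.2 ?_)
    rw [mem_closedBall_zero_iff] at ht
    rwa [Metric.mem_closedBall, dist_comm, dist_eq_norm]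
  have := h (t - w.1)
  rw [indicator_of_notMem ht] at this
  simp [le_antisymm this zero_le]

theorem le_const_of_le_indicator {R : ℝ} {C : ℝ≥0} {f : Path d}
    (h : ∀ s, f s ≤ (Metric.closedBall 0 R).indicator (fun _ => C) s) (s : Pt d) : f s ≤ C :=
  (h s).trans (indicator_le_self' (fun _ _ => zero_le) s)

end Score

/-! ### The spatial intensity measure and the law of the centres. -/

section SpatialMeasure

theorem isCompact_enlarge {D : Set (Pt d)} (hD : IsCompact D) {R : ℝ} (hR : 0 < R) :
    IsCompact (enlarge D R) := by
  rw [enlarge, ← hD.cthickening_eq_biUnion_closedBall hR.le]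
  exact hD.cthickening

instance (ψ : Path d) : IsLocallyFiniteMeasure (spatialMeasure ψ) :=
  IsLocallyFiniteMeasure.withDensity_coe ψ.continuous

instance (ψ : Path d) : SFinite (spatialMeasure ψ) := by
  unfold spatialMeasure; infer_instance

theorem spatialMeasure_ne_zero_of_isOpen {ψ : Path d} {U : Set (Pt d)} (hU : IsOpen U) {c : Pt d}
    (hc : c ∈ U) (hψ : 0 < ψ c) : spatialMeasure ψ U ≠ 0 := by
  intro h
  rw [spatialMeasure, withDensity_apply_eq_zero (by fun_prop)] at h
  have ho : IsOpen ({s | (ψ s : ℝ≥0∞) ≠ 0} ∩ U) := by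
    refine IsOpen.inter ?_ hU
    simp only [ne_eq, ENNReal.coe_eq_zero]
    exact isOpen_ne_fun ψ.continuous continuous_const
  exact (ho.measure_pos volume ⟨c, by simpa using hψ.ne', hc⟩).ne' h

theorem ball_subset_enlarge {D : Set (Pt d)} {c : Pt d} (hc : c ∈ D) (R : ℝ) :
    Metric.ball c R ⊆ enlarge D R :=
  Metric.ball_subset_closedBall.trans (subset_biUnion_of_mem (u := fun s => Metric.closedBall s R) hc)

variable {D : Set (Pt d)} {R : ℝ} {ψ : Path d}

theorem spatialMeasure_enlarge_ne_top (hD : IsCompact D) (hR : 0 < R) :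
    spatialMeasure ψ (enlarge D R) ≠ ∞ :=
  (isCompact_enlarge hD hR).measure_ne_top

theorem spatialMeasure_enlarge_ne_zero (hne : D.Nonempty) (hR : 0 < R)
    (hψ : ∀ s ∈ D, 0 < ψ s) : spatialMeasure ψ (enlarge D R) ≠ 0 := by
  obtain ⟨c, hc⟩ := hne
  exact fun h => spatialMeasure_ne_zero_of_isOpen Metric.isOpen_ball (Metric.mem_ball_self hR)
    (hψ c hc) (measure_mono_null (ball_subset_enlarge hc R) h)

theorem isProbabilityMeasure_centreLaw (hD : IsCompact D) (hne : D.Nonempty) (hR : 0 < R)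
    (hψ : ∀ s ∈ D, 0 < ψ s) : IsProbabilityMeasure (centreLaw (enlarge D R) ψ) := by
  constructor
  rw [centreLaw, Measure.smul_apply, Measure.restrict_apply_univ, smul_eq_mul]
  exact ENNReal.inv_mul_cancel (spatialMeasure_enlarge_ne_zero hne hR hψ)
    (spatialMeasure_enlarge_ne_top hD hR)

theorem centreLaw_ball_ne_zero (hD : IsCompact D) (hR : 0 < R) {c : Pt d} (hc : c ∈ D)
    (hψ : 0 < ψ c) {δ : ℝ} (hδ : 0 < δ) :
    centreLaw (enlarge D R) ψ (Metric.ball c δ) ≠ 0 := by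
  rw [centreLaw, Measure.smul_apply, smul_eq_mul,
    Measure.restrict_apply Metric.isOpen_ball.measurableSet]
  refine mul_ne_zero (ENNReal.inv_ne_zero.2 (spatialMeasure_enlarge_ne_top hD hR)) fun h => ?_
  -- The radius `min δ R` keeps the ball inside both `ball c δ` and `D_R`.
  refine spatialMeasure_ne_zero_of_isOpen Metric.isOpen_ball
    (Metric.mem_ball_self (lt_min hδ hR)) hψ (measure_mono_null ?_ h)
  exact subset_inter (Metric.ball_subset_ball (min_le_left _ _))
    ((Metric.ball_subset_ball (min_le_right _ _)).trans (ball_subset_enlarge hc R))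

theorem measurable_spatialMeasure {A : Set (Pt d)} (hA : MeasurableSet A) :
    Measurable fun ψ : Path d => spatialMeasure ψ A := by
  simp only [spatialMeasure, withDensity_apply _ hA]
  have h : Continuous fun w : Path d × Pt d => w.1 w.2 := by fun_prop
  exact Measurable.lintegral_prod_right' (ν := volume.restrict A)
    (f := fun w : Path d × Pt d => (w.1 w.2 : ℝ≥0∞)) h.measurable.coe_nnreal_ennreal

end SpatialMeasure

/-! ### Directing measure of the exceedance set. -/

section Intensity

instance : SFinite severityMeasure := by
  unfold severityMeasure; infer_instance

theorem lintegral_Ioi_zpow_neg_two {a : ℝ} (ha : 0 < a) :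
    ∫⁻ v in Ioi a, ENNReal.ofReal (v ^ (-2 : ℤ)) = ENNReal.ofReal a⁻¹ := by
  have hcongr : ∀ v ∈ Ioi a, v ^ (-2 : ℤ) = v ^ (-2 : ℝ) := fun v _ => by
    rw [← Real.rpow_intCast]; norm_num
  rw [setLIntegral_congr_fun measurableSet_Ioi fun v hv => by rw [hcongr v hv],
    ← ofReal_integral_eq_lintegral_ofReal
      (integrableOn_Ioi_rpow_of_lt (by norm_num) ha), integral_Ioi_rpow_of_lt (by norm_num) ha]
  · congr 1
    rw [show (-2 : ℝ) + 1 = -1 by norm_num, Real.rpow_neg_one]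
    ring
  · filter_upwards [ae_restrict_mem measurableSet_Ioi] with v hv
    exact Real.rpow_nonneg (ha.trans hv).le _

/-- For `g > 0` the set is the half-line above `1 / g`, and `u⁻²` integrates over it to `g`. This
turns exceedance measures into mean scores. -/
theorem severityMeasure_one_lt_mul {g : ℝ≥0∞} (hg : g ≠ ∞) :
    severityMeasure {u | 1 < u * g} = g := by
  have hm : MeasurableSet {u : ℝ≥0∞ | 1 < u * g} :=
    measurableSet_lt measurable_const (measurable_id.mul_const g)
  rcases eq_or_ne g 0 with rfl | h0
  · simp
  have hpos : 0 < g.toReal := ENNReal.toReal_pos h0 hg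
  rw [severityMeasure, Measure.map_apply ENNReal.measurable_ofReal hm,
    withDensity_apply _ (ENNReal.measurable_ofReal hm),
    Measure.restrict_restrict (ENNReal.measurable_ofReal hm)]
  have : ENNReal.ofReal ⁻¹' {u : ℝ≥0∞ | 1 < u * g} ∩ Ioi 0 = Ioi g.toReal⁻¹ := by
    ext v
    simp only [mem_inter_iff, mem_preimage, mem_ofPred_eq, mem_Ioi]
    have key : 0 < v → (1 < ENNReal.ofReal v * g ↔ g.toReal⁻¹ < v) := fun hv => by
      rw [← ENNReal.ofReal_toReal hg, ← ENNReal.ofReal_mul hv.le, ENNReal.one_lt_ofReal,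
        ENNReal.toReal_ofReal hpos.le, inv_lt_iff_one_lt_mul₀ hpos, mul_comm]
    constructor
    · rintro ⟨h1, h2⟩; exact (key h2).1 h1
    · intro h
      have hv : 0 < v := (inv_pos.2 hpos).trans h
      exact ⟨(key hv).2 h, hv⟩
  rw [this, lintegral_Ioi_zpow_neg_two (inv_pos.2 hpos), inv_inv, ENNReal.ofReal_toReal hg]

variable {D : Set (Pt d)} {J : Finset D} {y : D → ℝ≥0∞}

/-- The storms that exceed one of the thresholds `y` at one of the sites `J`. -/
def exceedance (J : Finset D) (y : D → ℝ≥0∞) : Set (Storm d) :=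
  {p | 1 < p.2.1 * score J y (p.1, p.2.2)}

theorem measurableSet_exceedance (J : Finset D) (y : D → ℝ≥0∞) :
    MeasurableSet (exceedance J y) :=
  measurableSet_lt measurable_const (measurable_snd.fst.mul
    ((measurable_score J y).comp (measurable_fst.prodMk measurable_snd.snd)))

/-- By Tonelli, integrating out the severity first leaves the score. Only centres in `D_R`
contribute, and normalising their law produces the factor `ν_ψ(D_R)`. -/
theorem stormIntensity_exceedance (PX : Measure (Path d)) [IsProbabilityMeasure PX]
    {μ : ℝ≥0} {C : ℝ≥0} {R : ℝ} {ψ : Path d} (hD : IsCompact D) (hne : D.Nonempty) (hR : 0 < R)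
    (hψ : ∀ s ∈ D, 0 < ψ s) (hy : ∀ t, y t ≠ 0)
    (hbdd : ∀ᵐ f ∂PX, ∀ s, f s ≤ (Metric.closedBall 0 R).indicator (fun _ => C) s) :
    stormIntensity PX μ ψ (exceedance J y) =
      ∫⁻ w, spatialMeasure ψ (enlarge D R) / μ * score J y w
        ∂((centreLaw (enlarge D R) ψ).prod PX) := by
  have hm := measurableSet_exceedance J y
  have hA := (isCompact_enlarge hD hR).measurableSet
  have := isProbabilityMeasure_centreLaw hD hne hR hψ
  have hinner : ∀ s, (severityMeasure.prod PX) (Prod.mk s ⁻¹' exceedance J y) =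
      ∫⁻ f, score J y (s, f) ∂PX := fun s => by
    rw [Measure.prod_apply_symm (measurable_prodMk_left hm)]
    refine lintegral_congr_ae ?_
    filter_upwards [hbdd] with f hf
    exact severityMeasure_one_lt_mul ((score_le_scoreBound (w := (s, f))
      (le_const_of_le_indicator hf)).trans_lt (scoreBound_lt_top hy C)).ne
  have houter : ∫⁻ s, ∫⁻ f, score J y (s, f) ∂PX ∂(spatialMeasure ψ) =
      ∫⁻ s in enlarge D R, ∫⁻ f, score J y (s, f) ∂PX ∂(spatialMeasure ψ) := by
    rw [← lintegral_indicator hA]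
    refine lintegral_congr fun s => ?_
    by_cases hs : s ∈ enlarge D R
    · rw [indicator_of_mem hs]
    · rw [indicator_of_notMem hs]
      refine (lintegral_congr_ae ?_).trans lintegral_zero
      filter_upwards [hbdd] with f hf
      exact score_eq_zero_of_notMem_enlarge (w := (s, f)) hf hs
  rw [lintegral_const_mul _ (measurable_score J y), lintegral_prod _
    (measurable_score J y).aemeasurable, centreLaw, lintegral_smul_measure, smul_eq_mul,
    stormIntensity, Measure.smul_apply, smul_eq_mul, Measure.prod_apply hm, lintegral_congr hinner,
    houter, ← mul_assoc]
  congr 1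
  rw [div_eq_mul_inv, mul_right_comm, ENNReal.mul_inv_cancel
    (spatialMeasure_enlarge_ne_zero hne hR hψ) (spatialMeasure_enlarge_ne_top hD hR), one_mul]

theorem stormIntensity_exceedance_lt_top (PX : Measure (Path d)) [IsProbabilityMeasure PX]
    {μ : ℝ≥0} (hμ : 0 < μ) {C : ℝ≥0} {R : ℝ} {ψ : Path d} (hD : IsCompact D) (hne : D.Nonempty)
    (hR : 0 < R) (hψ : ∀ s ∈ D, 0 < ψ s) (hy : ∀ t, y t ≠ 0)
    (hbdd : ∀ᵐ f ∂PX, ∀ s, f s ≤ (Metric.closedBall 0 R).indicator (fun _ => C) s) :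
    stormIntensity PX μ ψ (exceedance J y) < ∞ := by
  have := isProbabilityMeasure_centreLaw hD hne hR hψ
  rw [stormIntensity_exceedance PX hD hne hR hψ hy hbdd,
    lintegral_const_mul _ (measurable_score J y)]
  refine ENNReal.mul_lt_top (ENNReal.div_lt_top (spatialMeasure_enlarge_ne_top hD hR)
    (ENNReal.coe_ne_zero.2 hμ.ne')) ?_
  refine (lintegral_mono_ae (g := fun _ => scoreBound J y C) ?_).trans_lt ?_
  · exact Measure.quasiMeasurePreserving_snd.ae
      (hbdd.mono fun f hf => le_const_of_le_indicator hf) |>.mono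
        fun w hw => score_le_scoreBound hw
  · simpa using scoreBound_lt_top hy C

end Intensity

/-! ### Pathwise properties of the stopping rule. -/

section Deterministic

variable {Ω : Type*} {D : Set (Pt d)} {S : ℕ → Ω → Pt d} {X : ℕ → Ω → Path d} {ξ : ℕ → Ω → ℝ}
  {ω : Ω}

theorem monotone_arrival (hξ : ∀ i, 0 < ξ i ω) : Monotone fun n => arrival ξ n ω :=
  monotone_nat_of_le_succ fun n => by
    simp only [arrival, Finset.sum_range_succ]; linarith [hξ n]

theorem arrival_succ_pos (hξ : ∀ i, 0 < ξ i ω) (n : ℕ) : 0 < arrival ξ (n + 1) ω :=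
  Finset.sum_pos (fun i _ => hξ i) ⟨0, by simp⟩

theorem tendsto_arrival_atTop (hξ : ∀ i, 0 < ξ i ω) (hfreq : ∃ᶠ i in atTop, 1 ≤ ξ i ω) :
    Tendsto (fun n => arrival ξ n ω) atTop atTop := by
  refine tendsto_atTop_atTop_of_monotone (monotone_arrival hξ) fun b => ?_
  obtain ⟨K, hK⟩ := exists_nat_ge b
  suffices h : ∀ K : ℕ, ∃ n, (K : ℝ) ≤ arrival ξ n ω from
    (h K).imp fun n hn => hK.trans hn
  intro K
  induction K with
  | zero => exact ⟨0, by simp [arrival]⟩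
  | succ K ih =>
    obtain ⟨n, hn⟩ := ih
    obtain ⟨i, hi, h1⟩ := frequently_atTop.1 hfreq n
    refine ⟨i + 1, ?_⟩
    have h2 : arrival ξ n ω ≤ arrival ξ i ω := monotone_arrival hξ hi
    have h3 : arrival ξ (i + 1) ω = arrival ξ i ω + ξ i ω := Finset.sum_range_succ _ _
    push_cast
    linarith

/-- If finitely many positive shapes cover the compact domain and the arrival times diverge, then
the algorithm stops. -/
theorem stopIndex_lt_top {C : ℝ≥0} (hD : IsCompact D) (hne : D.Nonempty) (hξ : ∀ i, 0 < ξ i ω)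
    (hfreq : ∃ᶠ i in atTop, 1 ≤ ξ i ω) {r : ℝ} {F : Finset (Pt d)}
    (hF : D ⊆ ⋃ c ∈ F, Metric.ball c (r / 2))
    (hcover : ∀ c ∈ F, ∃ i, S i ω ∈ Metric.ball c (r / 2) ∧
      Metric.closedBall 0 r ⊆ {s | 0 < X i ω s}) :
    stopIndex D C S X ξ ω < ⊤ := by
  obtain ⟨n₀, hn₀⟩ : ∃ n₀ : ℕ, ∀ c ∈ F, ∃ i < n₀, S i ω ∈ Metric.ball c (r / 2) ∧
      Metric.closedBall 0 r ⊆ {s | 0 < X i ω s} := by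
    choose! i hi using hcover
    exact ⟨F.sup i + 1, fun c hc => ⟨i c, Nat.lt_succ_of_le (Finset.le_sup hc), hi c hc⟩⟩
  have hcont : Continuous fun t => (Finset.range n₀).sup fun i => X i ω (t - S i ω) :=
    Continuous.finset_sup_apply fun i _ => by fun_prop
  obtain ⟨t₀, ht₀, hmin⟩ := hD.exists_isMinOn hne hcont.continuousOn
  set ε := (Finset.range n₀).sup fun i => X i ω (t₀ - S i ω) with hεdef
  -- A site of `D` and some storm centre lie within `r / 2` of a common `c`, so their difference
  -- lies in the ball of radius `r` where that shape is positive.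
  have hε : 0 < ε := by
    obtain ⟨c, hc, htc⟩ := mem_iUnion₂.1 (hF ht₀)
    obtain ⟨i, hi, hS, hX⟩ := hn₀ c hc
    have hmem : t₀ - S i ω ∈ Metric.closedBall (0 : Pt d) r := by
      rw [mem_closedBall_zero_iff, ← dist_eq_norm]
      rw [Metric.mem_ball] at htc hS
      have := dist_triangle_right t₀ (S i ω) c
      linarith
    exact lt_of_lt_of_le (hX hmem)
      (Finset.le_sup (f := fun i => X i ω (t₀ - S i ω)) (Finset.mem_range.2 hi))
  have hεr : (0 : ℝ) < ε := hε
  -- With this `n`, `C / Γ_{n+1} ≤ ε / Γ_{n₀}`, and every storm of index `i < n₀` has `Γ_{i+1} ≤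
  -- Γ_{n₀}`.
  obtain ⟨n, hn, hn₀n, hn1⟩ : ∃ n, C * arrival ξ n₀ ω / ε ≤ arrival ξ (n + 1) ω ∧ n₀ ≤ n ∧ 1 ≤ n :=
    ((((tendsto_arrival_atTop hξ hfreq).comp (tendsto_add_atTop_nat 1)).eventually_ge_atTop
      (C * arrival ξ n₀ ω / ε)).and
        ((eventually_ge_atTop n₀).and (eventually_ge_atTop 1))).exists
  refine lt_of_le_of_lt (sInf_le ⟨n, rfl, hn1, le_iInf₂ fun t ht => ?_⟩) (ENat.natCast_lt_top n)
  have hεt : ε ≤ (Finset.range n₀).sup fun i => X i ω (t - S i ω) := hmin ht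
  obtain ⟨i, hi, hiX⟩ := (Finset.le_sup_iff (by exact hε)).1 hεt
  rw [Finset.mem_range] at hi
  refine le_trans ?_ (le_iSup₂_of_le i (Finset.mem_range.2 (hi.trans_le hn₀n)) le_rfl)
  have hi_pos := arrival_succ_pos hξ i
  have hile : arrival ξ (i + 1) ω ≤ arrival ξ n₀ ω := monotone_arrival hξ hi
  have hnpos := arrival_succ_pos hξ n
  calc (ENNReal.ofReal (arrival ξ (n + 1) ω))⁻¹ * (C : ℝ≥0∞)
      ≤ (ENNReal.ofReal (arrival ξ (i + 1) ω))⁻¹ * (ε : ℝ≥0∞) := by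
        rw [← ENNReal.ofReal_inv_of_pos hnpos, ← ENNReal.ofReal_inv_of_pos hi_pos,
          ← ENNReal.ofReal_coe_nnreal, ← ENNReal.ofReal_coe_nnreal,
          ← ENNReal.ofReal_mul (inv_nonneg.2 hnpos.le), ← ENNReal.ofReal_mul (inv_nonneg.2 hi_pos.le)]
        refine ENNReal.ofReal_le_ofReal ?_
        rw [inv_mul_le_iff₀ hnpos, ← mul_assoc, mul_comm _ (_)⁻¹, mul_assoc,
          le_inv_mul_iff₀ hi_pos]
        rw [div_le_iff₀ hεr] at hn
        refine le_trans ?_ hn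
        rw [mul_comm]
        exact mul_le_mul_of_nonneg_left hile C.coe_nonneg
    _ ≤ simTerm S X ξ i t ω := by
        rw [simTerm]; gcongr

/-- On the simulation domain, the storms after the stopping time do not contribute. -/
theorem simField_eq_iSup {R : ℝ} {C μ : ℝ≥0} {Ψ : Ω → Path d} (hξ : ∀ i, 0 < ξ i ω)
    (hX : ∀ i s, X i ω s ≤ C) {t : Pt d} (ht : t ∈ D) :
    simField D R C μ Ψ S X ξ t ω =
      spatialMeasure (Ψ ω) (enlarge D R) / (μ : ℝ≥0∞) * ⨆ i, simTerm S X ξ i t ω := by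
  rw [simField]
  congr 1
  refine le_antisymm (iSup_mono fun i => iSup_le fun _ => le_rfl) (iSup_le fun i => ?_)
  -- Index `i` is the storm number `i + 1`, so a storm is discarded when `T ≤ i`. Then `T` is finite
  -- and the infimum defining it is attained; if `T = ∞` nothing is discarded.
  by_cases hi : (i : ℕ∞) < stopIndex D C S X ξ ω
  · exact le_iSup₂_of_le i hi le_rfl
  have hlt : stopIndex D C S X ξ ω < ⊤ := (not_lt.1 hi).trans_lt (ENat.natCast_lt_top i)
  have hnonempty : {m : ℕ∞ | ∃ n : ℕ, m = n ∧ 1 ≤ n ∧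
    (ENNReal.ofReal (arrival ξ (n + 1) ω))⁻¹ * (C : ℝ≥0∞) ≤
      ⨅ t ∈ D, ⨆ i ∈ Finset.range n, simTerm S X ξ i t ω}.Nonempty := by
    by_contra h
    rw [not_nonempty_iff_eq_empty] at h
    rw [stopIndex, h, sInf_empty] at hlt
    exact hlt.ne rfl
  obtain ⟨n, hn, -, hle⟩ := csInf_mem hnonempty
  change stopIndex D C S X ξ ω = n at hn
  rw [hn, not_lt, Nat.cast_le] at hi
  calc simTerm S X ξ i t ω
      ≤ (ENNReal.ofReal (arrival ξ (n + 1) ω))⁻¹ * (C : ℝ≥0∞) := by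
        rw [simTerm]
        gcongr
        · exact monotone_arrival hξ (by omega)
        · exact hX i _
    _ ≤ ⨆ i ∈ Finset.range n, simTerm S X ξ i t ω := hle.trans (iInf₂_le t ht)
    _ ≤ _ := iSup₂_le fun j hj => le_iSup₂_of_le j
        (by rw [hn, Nat.cast_lt]; exact Finset.mem_range.1 hj) le_rfl

end Deterministic

/-! ### The algorithm's input as one i.i.d. sequence of marked waiting times. -/

section Input

/-- The three input sequences of the algorithm, regarded as one sequence of marked waiting times. -/
def zipInput (w : (ℕ → Pt d) × (ℕ → Path d) × (ℕ → ℝ)) : ℕ → (Pt d × Path d) × ℝ :=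
  fun i => ((w.1 i, w.2.1 i), w.2.2 i)

theorem measurable_zipInput : Measurable (zipInput (d := d)) := by
  unfold zipInput; fun_prop

theorem map_zipInput (a : Measure (Pt d)) (b : Measure (Path d)) (c : Measure ℝ)
    [IsProbabilityMeasure a] [IsProbabilityMeasure b] [IsProbabilityMeasure c] :
    ((Measure.infinitePi fun _ : ℕ => a).prod ((Measure.infinitePi fun _ : ℕ => b).prod
      (Measure.infinitePi fun _ : ℕ => c))).map zipInput =
      Measure.infinitePi fun _ : ℕ => (a.prod b).prod c := by
  rw [← map_zip_infinitePi (a.prod b) c, ← map_zip_infinitePi a b]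
  nth_rw 2 [← Measure.map_id (μ := Measure.infinitePi fun _ : ℕ => c)]
  rw [Measure.map_prod_map _ _ (by fun_prop) measurable_id,
    ← (measurePreserving_prodAssoc (Measure.infinitePi fun _ : ℕ => a)
    (Measure.infinitePi fun _ : ℕ => b) (Measure.infinitePi fun _ : ℕ => c)).map_eq,
    Measure.map_map measurable_zipInput (by fun_prop), Measure.map_map (by fun_prop) (by fun_prop)]
  rfl

/-- The event that no simulated storm, rescaled by `a`, exceeds a threshold. -/
def noExceedance {D : Set (Pt d)} (J : Finset D) (y : D → ℝ≥0∞) (a : ℝ≥0∞) :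
    Set (ℕ → (Pt d × Path d) × ℝ) :=
  {z | ∀ i, a * (ENNReal.ofReal (∑ k ∈ Finset.range (i + 1), (z k).2))⁻¹ *
    score J y (z i).1 ≤ 1}

variable {D : Set (Pt d)} {J : Finset D} {y : D → ℝ≥0∞}

theorem measurableSet_noExceedance_prod (J : Finset D) (y : D → ℝ≥0∞) :
    MeasurableSet {p : ℝ≥0∞ × (ℕ → (Pt d × Path d) × ℝ) | p.2 ∈ noExceedance J y p.1} := by
  have : {p : ℝ≥0∞ × (ℕ → (Pt d × Path d) × ℝ) | p.2 ∈ noExceedance J y p.1} =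
      ⋂ i, {p | p.1 * (ENNReal.ofReal (∑ k ∈ Finset.range (i + 1), (p.2 k).2))⁻¹ *
        score J y (p.2 i).1 ≤ 1} := by
    ext p; simp [noExceedance]
  rw [this]
  have hs := measurable_score J y
  refine MeasurableSet.iInter fun i => measurableSet_le ?_ measurable_const
  fun_prop

theorem measurableSet_noExceedance (J : Finset D) (y : D → ℝ≥0∞) (a : ℝ≥0∞) :
    MeasurableSet (noExceedance J y a) :=
  (measurableSet_noExceedance_prod J y).preimage (measurable_const.prodMk measurable_id)

/-- Apply `infinitePi_belowArrivals` to the mark `a * score`, which the bound on the shapes and the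
positivity of the thresholds make bounded. Almost surely the arrival times are positive, so dividing
by them is the same as comparing with them. -/
theorem infinitePi_noExceedance {Q : Measure (Pt d × Path d)} [IsProbabilityMeasure Q]
    {a : ℝ≥0∞} (ha : a ≠ ∞) {C : ℝ≥0} (hy : ∀ t, y t ≠ 0) (hQ : ∀ᵐ w ∂Q, ∀ s, w.2 s ≤ C) :
    (Measure.infinitePi fun _ : ℕ => Q.prod (expMeasure 1)) (noExceedance J y a) =
      ENNReal.ofReal (Real.exp (-(∫⁻ w, a * score J y w ∂Q).toReal)) := by
  have hbound : a * scoreBound J y C ≠ ∞ := ENNReal.mul_ne_top ha (scoreBound_lt_top hy C).ne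
  have hle : ∀ᵐ w ∂Q, a * score J y w ≤ a * scoreBound J y C := by
    filter_upwards [hQ] with w hw
    gcongr
    exact score_le_scoreBound hw
  have hm : Measurable fun w => a * score J y w := (measurable_score J y).const_mul a
  rw [← integral_toReal hm.aemeasurable (hle.mono fun w hw => hw.trans_lt hbound.lt_top),
    ← infinitePi_belowArrivals Q hm.ennreal_toReal (M := (a * scoreBound J y C).toReal)
      ENNReal.toReal_nonneg (ae_of_all _ fun _ => ENNReal.toReal_nonneg)
      (hle.mono fun w hw => ENNReal.toReal_mono hbound hw)]
  refine measure_congr ?_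
  have hae : ∀ᵐ p ∂(Q.prod (expMeasure 1)), a * score J y p.1 ≠ ∞ ∧ 0 < p.2 :=
    (Measure.quasiMeasurePreserving_fst.ae
      (hle.mono fun w hw => (hw.trans_lt hbound.lt_top).ne)).and
      (Measure.quasiMeasurePreserving_snd.ae ae_pos_expMeasure)
  filter_upwards [ae_forall_mem_infinitePi hae] with z hz
  refine propext (forall_congr' fun i => ?_)
  have hpos : 0 < ∑ k ∈ Finset.range (i + 1), (z k).2 :=
    Finset.sum_pos (fun k _ => (hz k).2) ⟨0, by simp⟩
  rw [zero_add, mul_right_comm, ← div_eq_mul_inv,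
    ENNReal.div_le_iff (by simpa using hpos) ENNReal.ofReal_ne_top, one_mul,
    ENNReal.le_ofReal_iff_toReal_le (hz i).1 hpos.le]

end Input

/-! ### Finite-dimensional distributions determine the joint law. -/

section FiniteDimensional

theorem generateFrom_Iic_ne_zero :
    MeasurableSpace.generateFrom {s : Set ℝ≥0∞ | ∃ b ≠ 0, Iic b = s} =
      (inferInstance : MeasurableSpace ℝ≥0∞) := by
  refine le_antisymm (MeasurableSpace.generateFrom_le ?_) ?_
  · rintro _ ⟨b, -, rfl⟩
    exact measurableSet_Iic
  · rw [BorelSpace.measurable_eq (α := ℝ≥0∞), borel_eq_generateFrom_Iic]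
    refine MeasurableSpace.generateFrom_le ?_
    rintro _ ⟨b, rfl⟩
    rcases eq_or_ne b 0 with rfl | hb
    -- The threshold `0` is recovered from positive ones; the term `n = 0` has threshold `∞` and is
    -- harmless.
    · have : (Iic (0 : ℝ≥0∞)) = ⋂ n : ℕ, Iic ((n : ℝ≥0∞)⁻¹) := by
        ext x
        simp only [mem_Iic, mem_iInter]
        refine ⟨fun h n => h.trans zero_le, fun h => ?_⟩
        exact ge_of_tendsto' ENNReal.tendsto_inv_nat_nhds_zero h
      rw [this]
      refine MeasurableSet.iInter fun n => MeasurableSpace.measurableSet_generateFrom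
        ⟨_, ?_, rfl⟩
      simp
    · exact MeasurableSpace.measurableSet_generateFrom ⟨b, hb, rfl⟩

/-- Joint laws of a random environment and a nonnegative field agree when all joint
probabilities of non-exceedance of positive thresholds at finitely many sites agree. -/
theorem ext_of_prod_Iic {𝓩 ι : Type*} [MeasurableSpace 𝓩] {ρ σ : Measure (𝓩 × (ι → ℝ≥0∞))}
    [IsFiniteMeasure ρ]
    (h : ∀ A : Set 𝓩, MeasurableSet A → ∀ (J : Finset ι) (y : ι → ℝ≥0∞), (∀ t, y t ≠ 0) →
      ρ (A ×ˢ {g | ∀ t ∈ J, g t ≤ y t}) = σ (A ×ˢ {g | ∀ t ∈ J, g t ≤ y t})) : ρ = σ := by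
  refine Measure.ext_prod fun {A B} hA hB => ?_
  -- For fixed `A`, restricting to `A` and projecting leaves finite measures on the product space of
  -- fields, where the boxes of lower intervals form a generating π-system.
  have key : (ρ.restrict (A ×ˢ univ)).map Prod.snd = (σ.restrict (A ×ˢ univ)).map Prod.snd := by
    refine ext_of_squareCylinders (fun _ => {s : Set ℝ≥0∞ | ∃ b ≠ 0, Iic b = s})
      (fun _ => generateFrom_Iic_ne_zero) (fun _ => ⟨⊤, by simp, Iic_top⟩) (fun _ => ?_)
      fun J t ht => ?_
    · rintro _ ⟨a, ha, rfl⟩ _ ⟨b, hb, rfl⟩ -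
      exact ⟨a ⊓ b, by simp [min_eq_iff, ha, hb], Iic_inter_Iic.symm⟩
    · choose y hy hyt using ht
      have hset : (J : Set ι).pi t = {g | ∀ t ∈ J, g t ≤ y t} := by
        ext g; simp [Set.mem_pi, ← hyt]
      have hmeas : MeasurableSet ((J : Set ι).pi t) :=
        MeasurableSet.pi (Finset.countable_toSet _) fun i _ => hyt i ▸ measurableSet_Iic
      have hpre : (Prod.snd ⁻¹' ((J : Set ι).pi t) ∩ A ×ˢ univ : Set (𝓩 × (ι → ℝ≥0∞))) =
          A ×ˢ {g | ∀ t ∈ J, g t ≤ y t} := by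
        rw [hset]; ext w; simp [and_comm]
      rw [Measure.map_apply measurable_snd hmeas, Measure.map_apply measurable_snd hmeas,
        Measure.restrict_apply (measurable_snd hmeas), Measure.restrict_apply (measurable_snd hmeas),
        hpre, h A hA J y hy]
  have hB' := congrArg (fun m => m B) key
  have hpre : (Prod.snd ⁻¹' B ∩ A ×ˢ univ : Set (𝓩 × (ι → ℝ≥0∞))) = A ×ˢ B := by
    ext w; simp [and_comm]
  simpa only [Measure.map_apply measurable_snd hB, Measure.restrict_apply (measurable_snd hB),
    hpre] using hB'

end FiniteDimensional

/-! ### Void probabilities of the Cox process. -/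

section PoissonSide

theorem IsPoissonLaw.measure_count_eq_zero {S : Type*} [MeasurableSpace S] {lam : Measure S}
    {Q : Measure (Measure S)} (h : IsPoissonLaw lam Q) {B : Set S} (hB : MeasurableSet B)
    (hfin : lam B < ∞) : Q {N | N B = 0} = ENNReal.ofReal (Real.exp (-(lam B).toReal)) := by
  have hlaw := h.count_law B hB hfin
  have h1 := hlaw.measure_eq (p := fun x => x = 0) (measurableSet_singleton 0)
  rw [h1, Measure.map_apply (measurable_of_countable _) (by exact measurableSet_singleton 0)]
  have : (fun k : ℕ => (k : ℝ≥0∞)) ⁻¹' {x | x = 0} = {0} := by ext; simp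
  rw [this, poissonMeasure_singleton]
  simp [ENNReal.toReal]

theorem pointProcess_eq_zero_iff {Ω S : Type*} [MeasurableSpace S] {p : ℕ → Ω → S} {B : Set S}
    (hB : MeasurableSet B) (ω : Ω) : pointProcess p ω B = 0 ↔ ∀ i, p i ω ∉ B := by
  rw [pointProcess, Measure.sum_apply _ hB, ENNReal.tsum_eq_zero]
  simp [Measure.dirac_apply' _ hB]

/-- Turns a finite-dimensional event of the field into a void event of the point process, whose
conditional probability is that of a Poisson count being zero. -/
theorem extremalField_le_iff {Ω : Type*} {D : Set (Pt d)} {J : Finset D} {y : D → ℝ≥0∞}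
    (hy : ∀ t, y t ≠ 0) (p : ℕ → Ω → Storm d) (ω : Ω) :
    (∀ t ∈ J, extremalField p t ω ≤ y t) ↔ pointProcess p ω (exceedance J y) = 0 := by
  rw [pointProcess_eq_zero_iff (measurableSet_exceedance J y)]
  simp only [exceedance, mem_ofPred_eq, not_lt, mul_score_le_one_iff hy, extremalField,
    iSup_le_iff]
  exact ⟨fun h i t ht => h t ht i, fun h t ht i => h i t ht⟩

theorem measurable_extremalField {Ω : Type*} [MeasurableSpace Ω] {p : ℕ → Ω → Storm d}
    (hp : ∀ i, Measurable (p i)) (t : Pt d) : Measurable fun ω => extremalField p t ω := by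
  refine Measurable.iSup fun i => ?_
  exact (hp i).snd.fst.mul
    (measurable_shape_apply (hp i).fst (hp i).snd.snd t).coe_nnreal_ennreal

/-- The probability of non-exceedance by a Cox extremal process, jointly with its intensity. -/
theorem IsCoxProcess.measure_extremalField_le {Ω : Type*} [MeasurableSpace Ω] {P : Measure Ω}
    [IsProbabilityMeasure P] {Z : Ω → Path d} {Lam : Path d → Measure (Storm d)}
    {p : ℕ → Ω → Storm d} (h : IsCoxProcess P Z Lam p) {D : Set (Pt d)} {J : Finset D}
    {y : D → ℝ≥0∞} (hy : ∀ t, y t ≠ 0) (hfin : ∀ᵐ z ∂(P.map Z), Lam z (exceedance J y) < ∞)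
    {A : Set (Path d)} (hA : MeasurableSet A) :
    P {ω | Z ω ∈ A ∧ ∀ t ∈ J, extremalField p t ω ≤ y t} =
      ∫⁻ z in A, ENNReal.ofReal (Real.exp (-(Lam z (exceedance J y)).toReal)) ∂(P.map Z) := by
  obtain ⟨κ, hκ, hcond, hpoi⟩ := h.cond_law
  have hZ := hcond.aemeasurable_fst
  have := Measure.isProbabilityMeasure_map (μ := P) hZ
  have hB := measurableSet_exceedance J y
  have hmeas : MeasurableSet {N : Measure (Storm d) | N (exceedance J y) = 0} :=
    Measure.measurable_coe hB (measurableSet_singleton 0)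
  simp only [extremalField_le_iff hy]
  have h1 := HasLaw.measure_eq hcond
    (p := fun w => w.1 ∈ A ∧ w.2 (exceedance J y) = 0) (hA.prod hmeas)
  rw [h1]
  change (P.map Z ⊗ₘ κ) (A ×ˢ {N : Measure (Storm d) | N (exceedance J y) = 0}) = _
  rw [Measure.compProd_apply_prod hA hmeas]
  refine lintegral_congr_ae (ae_restrict_of_ae ?_)
  filter_upwards [hpoi, hfin] with z hz hz'
  exact hz.measure_count_eq_zero hB hz'

end PoissonSide

/-! ### The field of all simulated storms, without stopping. -/

section SimulationSide

/-- The rescaled field of all simulated storms, as a function of the random input. -/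
noncomputable def fullField (D : Set (Pt d)) (R : ℝ) (μ : ℝ≥0)
    (w : Path d × (ℕ → Pt d) × (ℕ → Path d) × (ℕ → ℝ)) (t : D) : ℝ≥0∞ :=
  spatialMeasure w.1 (enlarge D R) / (μ : ℝ≥0∞) *
    ⨆ i, simTerm (fun i (v : (ℕ → Pt d) × (ℕ → Path d) × (ℕ → ℝ)) => v.1 i)
      (fun i v => v.2.1 i) (fun i v => v.2.2 i) i t w.2

variable {D : Set (Pt d)} {J : Finset D} {y : D → ℝ≥0∞} {R : ℝ}

theorem measurable_fullField (hD : IsCompact D) (hR : 0 < R) (μ : ℝ≥0) :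
    Measurable (fullField D R μ) := by
  have hν := measurable_spatialMeasure (isCompact_enlarge hD hR).measurableSet
  refine measurable_pi_iff.2 fun t => ?_
  refine ((hν.comp measurable_fst).div_const _).mul (Measurable.iSup fun i => ?_)
  refine Measurable.mul ?_ (measurable_shape_apply ?_ ?_ _).coe_nnreal_ennreal
  · simp only [arrival]; fun_prop
  · fun_prop
  · fun_prop

theorem fullField_le_iff (hy : ∀ t, y t ≠ 0) (μ : ℝ≥0)
    (w : Path d × (ℕ → Pt d) × (ℕ → Path d) × (ℕ → ℝ)) :
    (∀ t ∈ J, fullField D R μ w t ≤ y t) ↔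
      zipInput w.2 ∈ noExceedance J y (spatialMeasure w.1 (enlarge D R) / (μ : ℝ≥0∞)) := by
  simp only [noExceedance, mem_ofPred_eq, mul_score_le_one_iff hy, fullField, ENNReal.mul_iSup,
    iSup_le_iff]
  exact ⟨fun h i t ht => (mul_assoc _ _ _).trans_le (h t ht i),
    fun h t ht i => (mul_assoc _ _ _).symm.trans_le (h i t ht)⟩

end SimulationSide

/-! ### Averaging over the intensity, almost sure stopping, and comparison of the fields. -/

variable {D : Set (Pt d)} {R : ℝ} {C μ : ℝ≥0} {PΨ PX : Measure (Path d)}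
  [IsProbabilityMeasure PX]
  {Ω : Type*} [MeasurableSpace Ω] {P : Measure Ω} {Ψ : Ω → Path d} {S : ℕ → Ω → Pt d}
  {X : ℕ → Ω → Path d} {ξ : ℕ → Ω → ℝ}

theorem forall_pos_of_iInf_pos {ψ : Path d} (h : 0 < ⨅ s ∈ D, (ψ s : ℝ≥0∞)) :
    ∀ s ∈ D, 0 < ψ s := fun s hs =>
  ENNReal.coe_pos.1 (h.trans_le (iInf₂_le s hs))

/-- Events that are almost sure for the i.i.d. sequence of marked waiting times, whatever the
realization of the intensity, are almost sure for the random input of the algorithm. -/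
theorem IsSimulationInput.ae_of_infinitePi [IsProbabilityMeasure PΨ]
    (h : IsSimulationInput P PΨ PX (enlarge D R) Ψ S X ξ) (hD : IsCompact D) (hne : D.Nonempty)
    (hR : 0 < R) (hΨ : ∀ᵐ ψ ∂PΨ, ∀ s ∈ D, 0 < ψ s) {B : Set (ℕ → (Pt d × Path d) × ℝ)}
    (hB : MeasurableSet B)
    (hae : ∀ ψ : Path d, (∀ s ∈ D, 0 < ψ s) → ∀ᵐ z ∂(Measure.infinitePi fun _ : ℕ =>
      ((centreLaw (enlarge D R) ψ).prod PX).prod (expMeasure 1)), z ∈ B) :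
    ∀ᵐ ω ∂P, (fun i => ((S i ω, X i ω), ξ i ω)) ∈ B := by
  obtain ⟨κ, hκ, hcond, hlaw⟩ := h.cond_law
  have hjoint := h.law_intensity.prodMk_of_hasCondDistrib hcond
  refine ae_of_ae_map hjoint.aemeasurable (p := fun w => zipInput w.2 ∈ B) ?_
  rw [hjoint.map_eq]
  refine Measure.ae_compProd_of_ae_ae ((measurable_zipInput.comp measurable_snd) hB) ?_
  filter_upwards [hΨ, hlaw] with ψ hψ hκψ
  have := isProbabilityMeasure_centreLaw hD hne hR hψ
  refine ae_of_ae_map measurable_zipInput.aemeasurable (p := fun z => z ∈ B) ?_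
  rw [hκψ, map_zipInput]
  exact hae ψ hψ

/-- The probability of non-exceedance by the simulated field, jointly with its intensity. -/
theorem IsSimulationInput.measure_fullField_le [IsProbabilityMeasure PΨ]
    (h : IsSimulationInput P PΨ PX (enlarge D R) Ψ S X ξ) (hμ : 0 < μ) (hD : IsCompact D)
    (hne : D.Nonempty) (hR : 0 < R) (hΨ : ∀ᵐ ψ ∂PΨ, ∀ s ∈ D, 0 < ψ s)
    (hbdd : ∀ᵐ f ∂PX, ∀ s, f s ≤ (Metric.closedBall 0 R).indicator (fun _ => C) s)
    {J : Finset D} {y : D → ℝ≥0∞} (hy : ∀ t, y t ≠ 0) {A : Set (Path d)} (hA : MeasurableSet A) :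
    P {ω | Ψ ω ∈ A ∧ ∀ t ∈ J,
      fullField D R μ (Ψ ω, fun i => S i ω, fun i => X i ω, fun i => ξ i ω) t ≤ y t} =
      ∫⁻ ψ in A, ENNReal.ofReal
        (Real.exp (-(stormIntensity PX μ ψ (exceedance J y)).toReal)) ∂PΨ := by
  obtain ⟨κ, hκ, hcond, hlaw⟩ := h.cond_law
  have hjoint := h.law_intensity.prodMk_of_hasCondDistrib hcond
  have hν := measurable_spatialMeasure (isCompact_enlarge hD hR).measurableSet
  have hne_meas : MeasurableSet {w : Path d × (ℕ → Pt d) × (ℕ → Path d) × (ℕ → ℝ) |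
      zipInput w.2 ∈ noExceedance J y (spatialMeasure w.1 (enlarge D R) / (μ : ℝ≥0∞))} :=
    (measurableSet_noExceedance_prod J y).preimage
      (((hν.comp measurable_fst).div_const _).prodMk (measurable_zipInput.comp measurable_snd))
  have hmeas := (measurable_fst hA).inter hne_meas
  simp only [fullField_le_iff hy]
  rw [hjoint.measure_eq (p := fun w => w.1 ∈ A ∧
    zipInput w.2 ∈ noExceedance J y (spatialMeasure w.1 (enlarge D R) / (μ : ℝ≥0∞))) hmeas]
  refine (Measure.compProd_apply hmeas).trans ?_
  rw [← lintegral_indicator hA]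
  refine lintegral_congr_ae ?_
  filter_upwards [hΨ, hlaw] with ψ hψ hκψ
  by_cases hψA : ψ ∈ A
  · have := isProbabilityMeasure_centreLaw hD hne hR hψ
    rw [indicator_of_mem hψA, stormIntensity_exceedance PX hD hne hR hψ hy hbdd,
      ← infinitePi_noExceedance (ENNReal.div_ne_top (spatialMeasure_enlarge_ne_top hD hR)
        (ENNReal.coe_ne_zero.2 hμ.ne')) (C := C) hy
        (Measure.quasiMeasurePreserving_snd.ae
          (hbdd.mono fun f hf => le_const_of_le_indicator hf)),
      ← map_zipInput, Measure.map_apply measurable_zipInput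
        (measurableSet_noExceedance J y _), ← hκψ]
    congr 1
    ext v
    simp [hψA]
  · rw [indicator_of_notMem hψA]
    convert measure_empty (μ := κ ψ) using 2
    ext v
    simp [hψA]

/-- The algorithm stops almost surely. -/
theorem IsSimulationInput.ae_stopIndex_lt_top [IsProbabilityMeasure PΨ]
    (h : IsSimulationInput P PΨ PX (enlarge D R) Ψ S X ξ) (hD : IsCompact D) (hne : D.Nonempty)
    (hR : 0 < R) (hΨ : ∀ᵐ ψ ∂PΨ, ∀ s ∈ D, 0 < ψ s) (C : ℝ≥0) {r : ℝ} (hr : 0 < r)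
    (hpos : 0 < PX {f | Metric.closedBall 0 r ⊆ {s | 0 < f s}}) :
    ∀ᵐ ω ∂P, stopIndex D C S X ξ ω < ⊤ := by
  -- The subcover has centres in `D`, where `ψ` is positive; hence each ball receives a storm centre
  -- with positive probability, and jointly with a shape positive on the ball of radius `r`.
  obtain ⟨F, hFD, hF⟩ := hD.elim_finite_subcover_image (b := D)
    (c := fun c => Metric.ball c (r / 2)) (fun _ _ => Metric.isOpen_ball)
    (fun c hc => mem_biUnion hc (Metric.mem_ball_self (half_pos hr)))
  lift F to Finset (Pt d) using hF.1
  have hopen : MeasurableSet {f : Path d | Metric.closedBall 0 r ⊆ {s | 0 < f s}} :=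
    (ContinuousMap.isOpen_setOfPred_mapsTo (isCompact_closedBall (0 : Pt d) r)
      (isOpen_Ioi (a := (0 : ℝ≥0)))).measurableSet
  set V : Pt d → Set ((Pt d × Path d) × ℝ) := fun c =>
    (Metric.ball c (r / 2) ×ˢ {f | Metric.closedBall 0 r ⊆ {s | 0 < f s}}) ×ˢ univ with hV
  have hVm : ∀ c, MeasurableSet (V c) := fun c =>
    (Metric.isOpen_ball.measurableSet.prod hopen).prod .univ
  have hξ := h.ae_of_infinitePi hD hne hR hΨ (B := {z | ∀ i, 0 < (z i).2})
    (by
      simp only [ofPred_forall]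
      exact MeasurableSet.iInter fun i => measurableSet_lt measurable_const
        (measurable_pi_apply i).snd)
    (fun ψ hψ => by
      have := isProbabilityMeasure_centreLaw hD hne hR hψ
      exact ae_forall_mem_infinitePi (Measure.quasiMeasurePreserving_snd.ae ae_pos_expMeasure))
  have hfreq := h.ae_of_infinitePi hD hne hR hΨ
    -- Infinitely many waiting times of length at least `1` force the arrival times to diverge, with
    -- no need for a law of large numbers.
    (B := limsup (fun i => {z | (z i).2 ∈ Ici (1 : ℝ)}) atTop)
    (MeasurableSet.measurableSet_limsup fun i => (measurable_pi_apply i).snd measurableSet_Ici)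
    (fun ψ hψ => by
      have := isProbabilityMeasure_centreLaw hD hne hR hψ
      have hA : (((centreLaw (enlarge D R) ψ).prod PX).prod (expMeasure 1))
          (univ ×ˢ Ici (1 : ℝ)) ≠ 0 := by
        rw [Measure.prod_prod, measure_univ, one_mul]; exact expMeasure_Ici_ne_zero 1
      filter_upwards [ae_frequently_mem_infinitePi (.prod .univ measurableSet_Ici) hA] with z hz
      rw [mem_limsup_iff_frequently_mem]
      exact hz.mono fun i hi => hi.2)
  have hcover : ∀ c ∈ F, ∀ᵐ ω ∂P, ∃ i, ((S i ω, X i ω), ξ i ω) ∈ V c := fun c hc =>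
    h.ae_of_infinitePi hD hne hR hΨ (B := {z | ∃ i, z i ∈ V c})
      (by
        simp only [ofPred_exists]
        exact MeasurableSet.iUnion fun i => measurable_pi_apply i (hVm c))
      (fun ψ hψ => by
        have := isProbabilityMeasure_centreLaw hD hne hR hψ
        have hA : (((centreLaw (enlarge D R) ψ).prod PX).prod (expMeasure 1)) (V c) ≠ 0 := by
          rw [hV, Measure.prod_prod, Measure.prod_prod, measure_univ, mul_one]
          exact mul_ne_zero (centreLaw_ball_ne_zero hD hR (hFD hc) (hψ c (hFD hc)) (half_pos hr))
            hpos.ne'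
        filter_upwards [ae_frequently_mem_infinitePi (hVm c) hA] with z hz
        exact hz.exists)
  filter_upwards [hξ, hfreq, (F.eventually_all).2 hcover] with ω h1 h2 h3
  rw [mem_limsup_iff_frequently_mem] at h2
  exact stopIndex_lt_top hD hne h1 h2 hF.2 fun c hc => (h3 c hc).imp fun i hi => hi.1

/-- The simulated field agrees almost surely with the field of all simulated storms. -/
theorem IsSimulationInput.simField_ae_eq_fullField [IsProbabilityMeasure PΨ]
    (h : IsSimulationInput P PΨ PX (enlarge D R) Ψ S X ξ) (hD : IsCompact D) (hne : D.Nonempty)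
    (hR : 0 < R) (hΨ : ∀ᵐ ψ ∂PΨ, ∀ s ∈ D, 0 < ψ s)
    (hbdd : ∀ᵐ f ∂PX, ∀ s, f s ≤ (Metric.closedBall 0 R).indicator (fun _ => C) s) (μ : ℝ≥0) :
    ∀ᵐ ω ∂P, (fun t : D => simField D R C μ Ψ S X ξ t ω) =
      fullField D R μ (Ψ ω, fun i => S i ω, fun i => X i ω, fun i => ξ i ω) := by
  have hclosed : MeasurableSet {f : Path d | ∀ s, f s ≤ C} := by
    simp only [ofPred_forall]
    exact (isClosed_iInter fun s => isClosed_le (by fun_prop) continuous_const).measurableSet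
  have hae := h.ae_of_infinitePi hD hne hR hΨ
    (B := {z | ∀ i, 0 < (z i).2 ∧ (z i).1.2 ∈ {f : Path d | ∀ s, f s ≤ C}})
    (by
      rw [ofPred_forall]
      have hB : MeasurableSet {q : (Pt d × Path d) × ℝ |
          0 < q.2 ∧ q.1.2 ∈ {f : Path d | ∀ s, f s ≤ C}} :=
        (measurable_snd measurableSet_Ioi).inter ((measurable_snd.comp measurable_fst) hclosed)
      exact MeasurableSet.iInter fun i => hB.preimage (measurable_pi_apply i))
    (fun ψ hψ => by
      have := isProbabilityMeasure_centreLaw hD hne hR hψ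
      refine ae_forall_mem_infinitePi
        ((Measure.quasiMeasurePreserving_snd.ae ae_pos_expMeasure).and
          (Measure.quasiMeasurePreserving_fst.ae (Measure.quasiMeasurePreserving_snd.ae ?_)))
      exact hbdd.mono fun f hf => le_const_of_le_indicator hf)
  filter_upwards [hae] with ω hω
  ext t
  rw [simField_eq_iSup (fun i => (hω i).1) (fun i => (hω i).2) t.2]
  rfl

end CoxExtremal

theorem proposition1 {d : ℕ}
    -- law of the spatial intensity process, law of the storm shape, scaling constant
    (PΨ PX : Measure (CoxExtremal.Path d)) [IsProbabilityMeasure PΨ] [IsProbabilityMeasure PX]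
    (μ : ℝ≥0) (hμ : 0 < μ)
    -- the compact simulation domain
    (D : Set (CoxExtremal.Pt d)) (hD : IsCompact D) (hDne : D.Nonempty)
    -- the intensity process is almost surely bounded away from zero on `D`
    (hΨ : ∀ᵐ ψ ∂PΨ, 0 < ⨅ s ∈ D, (ψ s : ℝ≥0∞))
    -- with positive probability the shape is strictly positive on some fixed ball
    (hsupp : ∃ r : ℝ, 0 < r ∧ 0 < PX {f | Metric.closedBall 0 r ⊆ {s | 0 < f s}})
    -- the shape is bounded by `C` and vanishes outside the ball of radius `R`
    (C : ℝ≥0) (hC : 0 < C) (R : ℝ) (hR : 0 < R)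
    (hbdd : ∀ᵐ f ∂PX, ∀ s, f s ≤ (Metric.closedBall 0 R).indicator (fun _ => C) s)
    -- the Cox extremal process `Y = extremalField p`
    {Ω : Type*} [MeasurableSpace Ω] (P : Measure Ω) [IsProbabilityMeasure P]
    (Ψ : Ω → CoxExtremal.Path d) (p : ℕ → Ω → CoxExtremal.Storm d)
    (hY : CoxExtremal.IsCoxExtremalModel P PΨ PX μ Ψ p)
    -- the input of the simulation algorithm
    {Ω' : Type*} [MeasurableSpace Ω'] (P' : Measure Ω') [IsProbabilityMeasure P']
    (Ψ' : Ω' → CoxExtremal.Path d) (S : ℕ → Ω' → CoxExtremal.Pt d)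
    (X : ℕ → Ω' → CoxExtremal.Path d) (ξ : ℕ → Ω' → ℝ)
    (hsim : CoxExtremal.IsSimulationInput P' PΨ PX (CoxExtremal.enlarge D R) Ψ' S X ξ) :
    -- the stopping time is almost surely finite
    (∀ᵐ ω ∂P', CoxExtremal.stopIndex D C S X ξ ω < ⊤) ∧
    -- the simulated field has the law of `Y` restricted to `D`
    IdentDistrib
      (fun ω (t : D) => CoxExtremal.simField D R C μ Ψ' S X ξ t ω)
      (fun ω (t : D) => CoxExtremal.extremalField p t ω) P' P ∧
    -- and this also holds jointly with the intensity process, hence given its realization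
    IdentDistrib
      (fun ω => (Ψ' ω, fun t : D => CoxExtremal.simField D R C μ Ψ' S X ξ t ω))
      (fun ω => (Ψ ω, fun t : D => CoxExtremal.extremalField p t ω)) P' P := by
  have hΨ' : ∀ᵐ ψ ∂PΨ, ∀ s ∈ D, 0 < ψ s :=
    hΨ.mono fun ψ => CoxExtremal.forall_pos_of_iInf_pos
  obtain ⟨r, hr, hpos⟩ := hsupp
  have hΨ'm : AEMeasurable Ψ' P' := hsim.law_intensity.aemeasurable
  have hΨm : AEMeasurable Ψ P := hY.law_intensity.aemeasurable
  have hinput : AEMeasurable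
      (fun ω => (Ψ' ω, fun i => S i ω, fun i => X i ω, fun i => ξ i ω)) P' := by
    obtain ⟨κ, -, hcond, -⟩ := hsim.cond_law
    exact hcond.aemeasurable
  have hfull : AEMeasurable (fun ω => CoxExtremal.fullField D R μ
      (Ψ' ω, fun i => S i ω, fun i => X i ω, fun i => ξ i ω)) P' :=
    (CoxExtremal.measurable_fullField hD hR μ).comp_aemeasurable hinput
  have hext : Measurable fun ω (t : D) => CoxExtremal.extremalField p t ω :=
    measurable_pi_iff.2 fun t =>
      CoxExtremal.measurable_extremalField hY.cox.measurable_points t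
  have hjoint : IdentDistrib
      (fun ω => (Ψ' ω, CoxExtremal.fullField D R μ
        (Ψ' ω, fun i => S i ω, fun i => X i ω, fun i => ξ i ω)))
      (fun ω => (Ψ ω, fun t : D => CoxExtremal.extremalField p t ω)) P' P := by
    have hm1 := hΨ'm.prodMk hfull
    have hm2 := hΨm.prodMk hext.aemeasurable
    refine ⟨hm1, hm2, ?_⟩
    have := Measure.isProbabilityMeasure_map hm1
    refine CoxExtremal.ext_of_prod_Iic fun A hA J y hy => ?_
    have hbox : MeasurableSet (A ×ˢ {g : D → ℝ≥0∞ | ∀ t ∈ J, g t ≤ y t}) := by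
      refine hA.prod ?_
      simp only [ofPred_forall]
      exact Finset.measurableSet_biInter J fun t _ =>
        measurableSet_le (measurable_pi_apply t) measurable_const
    have hfin : ∀ᵐ ψ ∂(P.map Ψ),
        CoxExtremal.stormIntensity PX μ ψ (CoxExtremal.exceedance J y) < ∞ := by
      rw [hY.law_intensity.map_eq]
      filter_upwards [hΨ'] with ψ hψ
      exact CoxExtremal.stormIntensity_exceedance_lt_top PX hμ hD hDne hR hψ hy hbdd
    rw [Measure.map_apply_of_aemeasurable hm1 hbox, Measure.map_apply_of_aemeasurable hm2 hbox]
    refine (hsim.measure_fullField_le hμ hD hDne hR hΨ' hbdd hy hA).trans ?_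
    rw [← hY.law_intensity.map_eq]
    exact (hY.cox.measure_extremalField_le hy hfin hA).symm
  have hae := hsim.simField_ae_eq_fullField hD hDne hR hΨ' hbdd μ
  -- Measurability of the stopped field is inherited from the field of all storms, with which it
  -- agrees almost surely.
  have hres : IdentDistrib
      (fun ω => (Ψ' ω, fun t : D => CoxExtremal.simField D R C μ Ψ' S X ξ t ω))
      (fun ω => (Ψ ω, fun t : D => CoxExtremal.extremalField p t ω)) P' P :=
    (IdentDistrib.of_ae_eq (hΨ'm.prodMk hfull)
      (hae.mono fun ω hω => by simp [hω])).symm.trans hjoint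
  exact ⟨hsim.ae_stopIndex_lt_top hD hDne hR hΨ' C hr hpos, hres.comp measurable_snd, hres⟩
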